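/- Let $N\ge 2$, let $\mathcal H\subseteq\{1,\dots,N\}$ be the set of honest parties, let $\mathcal D$ be its complement (the dishonest parties, who may collude), and assume that the Verifier, one of the $N$ parties, is honest, i.e. belongs to $\mathcal H$. A *strategy* consists of a (complex, arbitrary-dimensional) Hilbert space $H_i$ for every $i\in\mathcal H$, a Hilbert space $H_{\mathcal D}$ of the dishonest group, a purifying space $H_P$, a unit vector $|\psi\rangle\in\bigotimes_{i\in\mathcal H}H_i\otimes H_{\mathcal D}\otimes H_P$ (a purification of the shared state), POVMs $\{\Pi^{(i)}_{a|x}\}_{a\in\{0,1\}}$ on $H_i$ for $i\in\mathcal H$, $x\in\{0,1\}$, and joint POVMs $\{\Pi_{\vec a_{\mathcal D}|\vec x_{\mathcal D}}\}_{\vec a_{\mathcal D}\in\{0,1\}^{\mathcal D}}$ on $H_{\mathcal D}$ for $\vec x_{\mathcal D}\in\{0,1\}^{\mathcal D}$. With $$p(\vec a|\vec x)=\langle\psi|\bigotimes_{i\in\mathcal H}\Pi^{(i)}_{a_i|x_i}\otimes\Pi_{\vec a_{\mathcal D}|\vec x_{\mathcal D}}\otimes 1|\psi\rangle ,$$ the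 Verifier, who chooses the inputs and collects the outputs, computes the Svetlichny value $$S_N^+=\sum_{\vec x\in\{0,1\}^N}(-1)^{w_{\vec x}(w_{\vec x}+1)/2}\sum_{\vec a\in\{0,1\}^N}(-1)^{a_1+\dots+a_N}\,p(\vec a|\vec x),$$ where $w_{\vec x}$ is the Hamming weight of $\vec x$. Then: (i) The maximum of $|S_N^+|$ over all strategies is $2^{N-1}\sqrt2$. (ii) If $|S_N^+|=2^{N-1}\sqrt2$ for a strategy, then there are Hilbert spaces $K_i$ ($i\in\mathcal H$) and $K_{\mathcal D}$, isometries $\Lambda_i:H_i\to\mathbb C^2\otimes K_i$ for the honest parties, an isometry $\Lambda'_{\mathcal D}:H_{\mathcal D}\to(\mathbb C^2)^{\otimes\mathcal D}\otimes K_{\mathcal D}$ for the dishonest group, and a unit vector $|\zeta\rangle\in\bigotimes_{i}K_i\otimes K_{\mathcal D}\otimes H_P$ such that $$\Big(\bigotimes_{i\in\mathcal H}\Lambda_i\otimes\Lambda'_{\mathcal D}\otimes 1\Big)|\psi\rangle=|\Phi^N\rangle\otimes|\zeta\rangle,\qquad |\Phi^N\rangle=\tfrac1{\sqrt2}\big(|0\rangle^{\otimes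 N}+|1\rangle^{\otimes N}\big).$$ Moreover, if $\mathcal D\neq\emptyset$ and $k=|\mathcal H|+1$, then for every $c\in\mathcal D$ there is an isometry $\Lambda_{\mathcal D}:H_{\mathcal D}\to\mathbb C^2\otimes K_{\mathcal D}$ with $$\Big(\bigotimes_{i\in\mathcal H}\Lambda_i\otimes\Lambda_{\mathcal D}\otimes 1\Big)|\psi\rangle=|\Phi^k\rangle\otimes|\zeta\rangle,$$ and $\Lambda'_{\mathcal D}$ is $\Lambda_{\mathcal D}$ followed by appending a qubit in the state $|0\rangle$ for each of the other $N-k$ dishonest parties and applying CNOT gates with these qubits as targets and the qubit of $\Lambda_{\mathcal D}$, which becomes the qubit of $c$, as control. -/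

import Mathlib

open scoped ComplexConjugate

universe u

noncomputable section

namespace DishonestSelfTest

/-- The Hilbert space with an orthonormal basis labelled by `α` (of any cardinality), i.e. the
square-summable functions on `α`; every complex Hilbert space is of this form. The Hilbert space
tensor product of two such spaces is the space over the product of the two label sets. -/
abbrev HSpace (α : Type u) : Type u := lp (fun _ : α => ℂ) 2

open Classical in
/-- The matrix element `⟨b|T|a⟩` of a bounded operator. -/
def entry {α β : Type u} (T : HSpace α →L[ℂ] HSpace β) (b : β) (a : α) : ℂ :=
  T (lp.single 2 a (1 : ℂ)) b

/-- The amplitudes of `(⨂ᵢ Aᵢ ⊗ B ⊗ 1)|ψ⟩`. The operators `Aᵢ` act on the individual parties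
`i : ι`, the operator `B` on one further system `δ`, and the identity on the last system `π`.
The series converges absolutely: the rows of bounded operators are square-summable, and so is
`ψ`. -/
def tensorApply {ι : Type} [Fintype ι] {α β : ι → Type u} {δ ε π : Type u}
    (A : ∀ i, HSpace (α i) →L[ℂ] HSpace (β i)) (B : HSpace δ →L[ℂ] HSpace ε)
    (ψ : HSpace ((∀ i, α i) × δ × π)) : (∀ i, β i) × ε × π → ℂ :=
  fun z => ∑' y : (∀ i, α i) × δ,
    (∏ i, entry (A i) (z.1 i) (y.1 i)) * entry B z.2.1 y.2 * ψ (y.1, y.2, z.2.2)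

/-- The index type of the dishonest parties when `H` is the set of honest ones. -/
abbrev Dishonest {N : ℕ} (H : Finset (Fin N)) : Type := {j : Fin N // j ∉ H}

/-- A quantum realization of the `N`-party Bell scenario with binary inputs and outputs in which
the parties in `H` are honest and the others collude. It consists of a Hilbert space for every
honest party, one for the group of dishonest parties and one for a purifying system; a purification
`|ψ⟩` of the shared state, a unit vector in the tensor product of all of these; a POVM for every
honest party and input; and a joint POVM, whose outcomes are the strings of outputs of the dishonest
parties, for every string of inputs of the dishonest parties. -/
structure Strategy {N : ℕ} (H : Finset (Fin N)) where
  honestLabel : H → Type u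
  dishonestLabel : Type u
  purifierLabel : Type u
  state : HSpace ((∀ i, honestLabel i) × dishonestLabel × purifierLabel)
  norm_state : ‖state‖ = 1
  honestPOVM : ∀ i : H, Fin 2 → Fin 2 → HSpace (honestLabel i) →L[ℂ] HSpace (honestLabel i)
  honestPOVM_pos : ∀ i x a, (honestPOVM i x a).IsPositive
  honestPOVM_sum : ∀ i x, ∑ a, honestPOVM i x a = 1
  dishonestPOVM : (Dishonest H → Fin 2) → (Dishonest H → Fin 2) →
    HSpace dishonestLabel →L[ℂ] HSpace dishonestLabel
  dishonestPOVM_pos : ∀ x a, (dishonestPOVM x a).IsPositive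
  dishonestPOVM_sum : ∀ x, ∑ a, dishonestPOVM x a = 1

/-- The Hamming weight of a bit string. -/
def weight {N : ℕ} (x : Fin N → Fin 2) : ℕ := ∑ i, (x i : ℕ)

namespace Strategy

variable {N : ℕ} {H : Finset (Fin N)}

/-- The probability `p(a|x)` of the outputs `a` given the inputs `x` (Born rule). -/
def prob (S : Strategy.{u} H) (x a : Fin N → Fin 2) : ℝ :=
  (∑' z, conj (S.state z) *
    tensorApply (fun i : H => S.honestPOVM i (x i) (a i))
      (S.dishonestPOVM (fun j => x j) (fun j => a j)) S.state z).re

/-- The correlator: the probability that the outputs have even parity minus the probability that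
they have odd parity. -/
def correlator (S : Strategy.{u} H) (x : Fin N → Fin 2) : ℝ :=
  ∑ a : Fin N → Fin 2, (-1) ^ weight a * S.prob x a

/-- The Svetlichny expression `S_N⁺`. -/
def svetlichny (S : Strategy.{u} H) : ℝ :=
  ∑ x : Fin N → Fin 2, (-1) ^ (weight x * (weight x + 1) / 2) * S.correlator x

end Strategy

open Classical in
/-- The amplitudes of the GHZ state `(|0…0⟩ + |1…1⟩)/√2` of qubits labelled by `ι`. -/
def ghz {ι : Type} (τ : ι → Fin 2) : ℂ :=
  ((if ∀ i, τ i = 0 then 1 else 0) + (if ∀ i, τ i = 1 then 1 else 0)) / (√2 : ℝ)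

open Classical in
/-- The vector `|f⟩` of a qubit and a further system, with a qubit in the state `|0⟩` appended for
every `j ≠ c`; the original qubit gets the label `c`. -/
def appendZeros {J : Type} {κ : Type u} (c : J) (f : Fin 2 × κ → ℂ) :
    (J → Fin 2) × κ → ℂ :=
  fun z => if ∀ j, j ≠ c → z.1 j = 0 then f (z.1 c, z.2) else 0

open Classical in
/-- The action on basis labels of the CNOT gates with control `c` and each `j ≠ c` as a target. -/
def cnotLabel {J : Type} (c : J) (t : J → Fin 2) : J → Fin 2 :=
  fun j => if j = c then t c else t j + t c

/-- The action on amplitudes of the CNOT gates with control `c` and each `j ≠ c` as a target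
(`cnotLabel c` is its own inverse). -/
def cnot {J : Type} {κ : Type u} (c : J) (f : (J → Fin 2) × κ → ℂ) : (J → Fin 2) × κ → ℂ :=
  fun z => f (cnotLabel c z.1, z.2)

namespace Strategy

variable {N : ℕ} {H : Finset (Fin N)}

/-- The state of the strategy is the `N`-partite GHZ state up to local isometries of the honest
parties and a global isometry of the dishonest parties: there are isometries `Λᵢ` of the honest
parties `i`, each into a qubit and an auxiliary system, an isometry `Λ'` of the dishonest group into
one qubit for every dishonest party and an auxiliary system, and a unit vector `ζ` of the
auxiliary systems and the purifying system, such that `(⨂ᵢ Λᵢ ⊗ Λ')|ψ⟩ = |GHZ_N⟩ ⊗ |ζ⟩`.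
Moreover, if there are dishonest parties, then for any choice `c` of one of them there is an
isometry `Λ_D` of the dishonest group into one qubit and the same auxiliary system such that
`(⨂ᵢ Λᵢ ⊗ Λ_D)|ψ⟩` is the GHZ state of the honest parties and the group (tensored with `|ζ⟩`), and
such that `Λ'` is `Λ_D` followed by CNOT gates from its qubit (which becomes the qubit of `c`) to
qubits, one for each of the other dishonest parties, that are appended in the state `|0⟩`. -/
def CertifiesGHZ (S : Strategy.{u} H) : Prop :=
  ∃ (κ : H → Type u) (κ' : Type u)
    (Λ : ∀ i, HSpace (S.honestLabel i) →ₗᵢ[ℂ] HSpace (Fin 2 × κ i))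
    (Λ' : HSpace S.dishonestLabel →ₗᵢ[ℂ] HSpace ((Dishonest H → Fin 2) × κ'))
    (ζ : HSpace ((∀ i, κ i) × κ' × S.purifierLabel)),
    ‖ζ‖ = 1 ∧
    (∀ (τ : Fin N → Fin 2) (k : ∀ i, κ i) (d : κ') (p : S.purifierLabel),
      tensorApply (fun i => (Λ i).toContinuousLinearMap) Λ'.toContinuousLinearMap S.state
        (fun i => (τ i, k i), (fun j => τ j, d), p) = ghz τ * ζ (k, d, p)) ∧
    ∀ c : Dishonest H, ∃ ΛD : HSpace S.dishonestLabel →ₗᵢ[ℂ] HSpace (Fin 2 × κ'),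
      (∀ (τ : Option H → Fin 2) (k : ∀ i, κ i) (d : κ') (p : S.purifierLabel),
        tensorApply (fun i => (Λ i).toContinuousLinearMap) ΛD.toContinuousLinearMap S.state
          (fun i => (τ (some i), k i), (τ none, d), p) = ghz τ * ζ (k, d, p)) ∧
      ∀ v : HSpace S.dishonestLabel,
        (Λ' v : (Dishonest H → Fin 2) × κ' → ℂ) = cnot c (appendZeros c (ΛD v))

end Strategy

end DishonestSelfTest

end

noncomputable section

namespace DishonestSelfTest

/-! ### Operators on one factor of a bipartite system. -/

section Slices

variable {X α γ : Type u}

/-! Bound. Fix an honest party `v` and any other party `b`. The flips of the inputs of `v` and `b`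
split the inputs into orbits of four, and the product of the four Svetlichny signs in an orbit is
-1. So each orbit gives a CHSH expression between the observables of `v` and the product of all
other observables (`svSign_flipInput`, `four_mul_svetlichny`), at most `2√2` by a sum of squares
(`chsh_defect`).

Rigidity. At the maximum every square vanishes (`relations_of_max`). The sum and difference of the
observables of `v`, suitably scaled, anticommute on the state `ψ` like Pauli operators, and each
equals on `ψ` an operator of the other systems. Choosing `b` to be another honest party, or a member
of the group, carries the anticommutation over to that subsystem (`pair_relations`). Relations that
hold on `ψ` become operator relations on the support of the reduced state, where they define a
projection `P = |1⟩⟨1|` and a flip `F` (`exists_swap`).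

All the projections send `ψ` to the same vector `φ`, and the product of all flips fixes `ψ` and
exchanges `φ` with `ψ - φ`. Hence the local isometries `v ↦ |0⟩ ⊗ (1 - P) v + |1⟩ ⊗ F P v` kill
every mixed string and give `ψ - φ` on both constant strings: a GHZ state times `√2 (ψ - φ)`
(`tensorOp_swapOp_apply`). The group counts as one party with one qubit, which is then repeated for
each of its members (`sumIsometry_repeatOp`).

Attainment. Equatorial measurements on a GHZ state have correlators `cos (π/4 + w π/2)`, whose sign
at weight `w` is the Svetlichny sign (`cos_add_mul_pi_div_two`). -/

theorem HSpace.hasSum_norm_sq (f : HSpace α) : HasSum (fun a => ‖f a‖ ^ 2) (‖f‖ ^ 2) := by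
  have h := lp.hasSum_norm (p := 2) (by norm_num) f
  simpa using h

theorem memℓp_two_iff {f : α → ℂ} : Memℓp f 2 ↔ Summable (fun a => ‖f a‖ ^ 2) := by
  rw [memℓp_gen_iff (by norm_num)]
  simp

theorem summable_norm_sq_of_slices (e : X ≃ γ × α) (F : γ → HSpace α)
    (hF : Summable fun g => ‖F g‖ ^ 2) :
    Summable fun x => ‖F (e x).1 (e x).2‖ ^ 2 := by
  rw [← e.symm.summable_iff]
  have : ((fun x => ‖F (e x).1 (e x).2‖ ^ 2) ∘ e.symm) = fun p : γ × α => ‖F p.1 p.2‖ ^ 2 := by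
    ext p; simp
  rw [this, summable_prod_of_nonneg (fun _ => by positivity)]
  refine ⟨fun g => (F g).hasSum_norm_sq.summable, ?_⟩
  simpa only [(HSpace.hasSum_norm_sq _).tsum_eq] using hF

/-- The vector of a bipartite system with given slices along the first factor. -/
def ofSlices (e : X ≃ γ × α) (F : γ → HSpace α) (hF : Summable fun g => ‖F g‖ ^ 2) : HSpace X :=
  ⟨fun x => F (e x).1 (e x).2, memℓp_two_iff.2 (summable_norm_sq_of_slices e F hF)⟩

/-- The (unnormalized) vector of the second factor obtained by projecting the first one on a basis
vector. -/
def slice (e : X ≃ γ × α) (f : HSpace X) (g : γ) : HSpace α :=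
  ⟨fun a => f (e.symm (g, a)), memℓp_two_iff.2 <|
    ((e.symm.summable_iff).2 f.hasSum_norm_sq.summable).comp_injective
      (i := fun a => (g, a)) fun _ _ h => (Prod.ext_iff.1 h).2⟩

@[simp]
theorem slice_apply (e : X ≃ γ × α) (f : HSpace X) (g : γ) (a : α) :
    slice e f g a = f (e.symm (g, a)) := rfl

theorem hasSum_slice_norm_sq (e : X ≃ γ × α) (f : HSpace X) :
    HasSum (fun g => ‖slice e f g‖ ^ 2) (‖f‖ ^ 2) :=
  ((e.symm.hasSum_iff).2 f.hasSum_norm_sq).prod_fiberwise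
    fun g => (slice e f g).hasSum_norm_sq

theorem hasSum_slice_inner (e : X ≃ γ × α) (f f' : HSpace X) :
    HasSum (fun g => inner ℂ (slice e f g) (slice e f' g)) (inner ℂ f f') :=
  ((e.symm.hasSum_iff).2 (lp.hasSum_inner f f')).prod_fiberwise
    fun g => lp.hasSum_inner (slice e f g) (slice e f' g)

theorem slice_ext (e : X ≃ γ × α) {f f' : HSpace X} (h : ∀ g, slice e f g = slice e f' g) :
    f = f' := by
  ext x
  have := congrArg (fun v : HSpace α => v (e x).2) (h (e x).1)
  simpa using this

@[simp]
theorem slice_ofSlices (e : X ≃ γ × α) (F : γ → HSpace α) (hF) (g : γ) :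
    slice e (ofSlices e F hF) g = F g := by
  ext a
  change F (e (e.symm (g, a))).1 (e (e.symm (g, a))).2 = _
  simp

theorem slice_add (e : X ≃ γ × α) (f f' : HSpace X) (g : γ) :
    slice e (f + f') g = slice e f g + slice e f' g := rfl

theorem slice_smul (e : X ≃ γ × α) (c : ℂ) (f : HSpace X) (g : γ) :
    slice e (c • f) g = c • slice e f g := rfl

theorem summable_map_slice (e : X ≃ γ × α) (T : HSpace α →L[ℂ] HSpace α) (f : HSpace X) :
    Summable fun g => ‖T (slice e f g)‖ ^ 2 := by
  refine .of_nonneg_of_le (fun _ => by positivity) (fun g => ?_)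
    ((hasSum_slice_norm_sq e f).summable.mul_left (‖T‖ ^ 2))
  rw [← mul_pow]
  gcongr
  exact T.le_opNorm _

theorem norm_ofSlices_map_le (e : X ≃ γ × α) (T : HSpace α →L[ℂ] HSpace α) (f : HSpace X) :
    ‖ofSlices e (fun g => T (slice e f g)) (summable_map_slice e T f)‖ ≤ ‖T‖ * ‖f‖ := by
  refine (pow_le_pow_iff_left₀ (norm_nonneg _) (by positivity) two_ne_zero).1 ?_
  rw [mul_pow]
  refine hasSum_le (fun g => ?_)
    (hasSum_slice_norm_sq e (ofSlices e (fun g => T (slice e f g)) (summable_map_slice e T f)))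
    ((hasSum_slice_norm_sq e f).mul_left _)
  rw [slice_ofSlices, ← mul_pow]
  gcongr
  exact T.le_opNorm _

/-- The operator `1 ⊗ T` on a bipartite system. -/
def actCLM (e : X ≃ γ × α) (T : HSpace α →L[ℂ] HSpace α) : HSpace X →L[ℂ] HSpace X :=
  LinearMap.mkContinuous
    { toFun f := ofSlices e (fun g => T (slice e f g)) (summable_map_slice e T f)
      map_add' f f' := slice_ext e fun g => by simp [slice_add]
      map_smul' c f := slice_ext e fun g => by simp [slice_smul] }
    ‖T‖ (norm_ofSlices_map_le e T)

theorem slice_actCLM (e : X ≃ γ × α) (T : HSpace α →L[ℂ] HSpace α) (f : HSpace X) (g : γ) :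
    slice e (actCLM e T f) g = T (slice e f g) :=
  slice_ofSlices e (fun g => T (slice e f g)) (summable_map_slice e T f) g

/-- The `*`-homomorphism `T ↦ 1 ⊗ T`. -/
def act (e : X ≃ γ × α) :
    (HSpace α →L[ℂ] HSpace α) →⋆ₐ[ℂ] (HSpace X →L[ℂ] HSpace X) where
  toFun := actCLM e
  map_one' := by ext1 f; exact slice_ext e fun g => by simp [slice_actCLM]
  map_mul' S T := by ext1 f; exact slice_ext e fun g => by simp [slice_actCLM]
  map_zero' := by
    ext1 f; exact slice_ext e fun g => by rw [slice_actCLM]; rfl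
  map_add' S T := by ext1 f; exact slice_ext e fun g => by simp [slice_actCLM, slice_add]
  commutes' c := by
    ext1 f
    exact slice_ext e fun g => by
      simp [slice_actCLM, slice_smul, Algebra.algebraMap_eq_smul_one]
  map_star' T := by
    rw [ContinuousLinearMap.star_eq_adjoint, ContinuousLinearMap.star_eq_adjoint,
      ContinuousLinearMap.eq_adjoint_iff]
    intro f f'
    refine (hasSum_slice_inner e _ _).unique ?_
    have h := hasSum_slice_inner e f (actCLM e T f')
    simpa only [slice_actCLM, ContinuousLinearMap.adjoint_inner_left] using h

theorem slice_act (e : X ≃ γ × α) (T : HSpace α →L[ℂ] HSpace α) (f : HSpace X) (g : γ) :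
    slice e (act e T f) g = T (slice e f g) :=
  slice_actCLM e T f g

theorem act_apply (e : X ≃ γ × α) (T : HSpace α →L[ℂ] HSpace α) (f : HSpace X) (x : X) :
    act e T f x = T (slice e f (e x).1) (e x).2 := rfl

theorem norm_act_le (e : X ≃ γ × α) (T : HSpace α →L[ℂ] HSpace α) : ‖act e T‖ ≤ ‖T‖ :=
  LinearMap.mkContinuous_norm_le _ (norm_nonneg _) (norm_ofSlices_map_le e T)

/-- The projection onto the support of the reduced state of a vector of a bipartite system. -/
theorem exists_support_projection (e : X ≃ γ × α) (f : HSpace X) :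
    ∃ E : HSpace α →L[ℂ] HSpace α, star E = E ∧ E * E = E ∧ act e E f = f ∧
      ∀ T : HSpace α →L[ℂ] HSpace α, act e T f = 0 → T * E = 0 := by
  -- The closed span of the slices is the closure of the range of the reduced density operator.
  set V : Submodule ℂ (HSpace α) :=
    (Submodule.span ℂ (Set.range (slice e f))).topologicalClosure with hV
  have hVc : IsClosed (V : Set (HSpace α)) := Submodule.isClosed_topologicalClosure _
  have : CompleteSpace V := hVc.completeSpace_coe
  refine ⟨V.starProjection, ?_, V.isIdempotentElem_starProjection, ?_, fun T hT => ?_⟩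
  · exact (isStarProjection_starProjection (U := V)).isSelfAdjoint
  · refine slice_ext e fun g => ?_
    rw [slice_act, Submodule.starProjection_eq_self_iff]
    exact Submodule.le_topologicalClosure _ (Submodule.subset_span ⟨g, rfl⟩)
  -- The slices of `act e T f` are `T` applied to those of `f`, so the closed kernel of `T` contains
  -- every slice.
  · have hle : V ≤ LinearMap.ker (T : HSpace α →ₗ[ℂ] HSpace α) := by
      refine Submodule.topologicalClosure_minimal _ (Submodule.span_le.2 ?_) T.isClosed_ker
      rintro _ ⟨g, rfl⟩
      have := slice_act e T f g
      rw [hT] at this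
      exact this.symm
    ext1 v
    exact hle (Submodule.starProjection_apply_mem V v)

end Slices

/-! ### Matrix elements of bounded operators. -/

section Basis

variable {α β X : Type u}

open Classical in
/-- The basis vector with label `a`. -/
def ket (a : α) : HSpace α := lp.single 2 a 1

open Classical in
theorem ket_apply (a b : α) : ket a b = if b = a then (1 : ℂ) else 0 := by
  simp [ket, Pi.single_apply]

theorem entry_eq (T : HSpace α →L[ℂ] HSpace β) (b : β) (a : α) : entry T b a = T (ket a) b := rfl

/-- The basis expansion converges in norm, so a bounded operator followed by a coordinate functional
may be applied term by term. -/
theorem hasSum_entry (T : HSpace α →L[ℂ] HSpace β) (f : HSpace α) (b : β) :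
    HasSum (fun a => entry T b a * f a) (T f b) := by
  classical
  have h := (lp.hasSum_single (p := 2) (by norm_num) f).map
    ((lp.evalCLM ℂ (fun _ : β => ℂ) 2 b).comp T) (ContinuousLinearMap.continuous _)
  convert! h using 1
  ext a
  have : lp.single 2 a (f a) = f a • ket a := by
    rw [ket, ← lp.single_smul]
    ext c
    simp [Pi.single_apply]
  simp only [Function.comp_apply, this, map_smul, smul_eq_mul, entry_eq, mul_comm (T (ket a) b)]
  rfl

theorem clm_ext_entry {S T : HSpace α →L[ℂ] HSpace β} (h : ∀ b a, entry S b a = entry T b a) :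
    S = T := by
  ext f b
  refine (hasSum_entry S f b).unique ?_
  simp only [h]
  exact hasSum_entry T f b

theorem entry_one [DecidableEq α] (b a : α) :
    entry (1 : HSpace α →L[ℂ] HSpace α) b a = if b = a then 1 else 0 := by
  rw [entry_eq]; simp [ket_apply]

theorem entry_sum {J : Type*} (s : Finset J) (T : J → HSpace α →L[ℂ] HSpace β) (b : β) (a : α) :
    entry (∑ j ∈ s, T j) b a = ∑ j ∈ s, entry (T j) b a := by
  simp only [entry_eq, sum_apply, lp.coeFn_sum]
  exact Finset.sum_apply _ _ _

theorem entry_smul (c : ℂ) (T : HSpace α →L[ℂ] HSpace β) (b : β) (a : α) :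
    entry (c • T) b a = c * entry T b a := by
  simp [entry_eq]

end Basis

/-! ### Commutation of operators on different factors. -/

section Commute

variable {X α₁ α₂ γ₁ γ₂ : Type u}

/-- The label obtained by changing the second component of a label to `a`. -/
def put (e : X ≃ γ₁ × α₁) (x : X) (a : α₁) : X := e.symm ((e x).1, a)

theorem put_eq_iff (e : X ≃ γ₁ × α₁) (x z : X) (a : α₁) :
    put e z a = x ↔ (e z).1 = (e x).1 ∧ a = (e x).2 := by
  rw [put, Equiv.symm_apply_eq, Prod.ext_iff]

theorem slice_apply_put (e : X ≃ γ₁ × α₁) (f : HSpace X) (z : X) (a : α₁) :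
    slice e f (e z).1 a = f (put e z a) := rfl

open Classical in
theorem entry_act (e : X ≃ γ₁ × α₁) (T : HSpace α₁ →L[ℂ] HSpace α₁) (z x : X) :
    entry (act e T) z x =
      if put e z (e x).2 = x then entry T (e z).2 (e x).2 else 0 := by
  rw [entry_eq, act_apply]
  have : slice e (ket x) (e z).1 = (if put e z (e x).2 = x then (1 : ℂ) else 0) • ket (e x).2 := by
    ext a
    rw [slice_apply_put, ket_apply]
    simp only [put_eq_iff, lp.coeFn_smul, Pi.smul_apply, ket_apply, smul_eq_mul]
    by_cases h : (e z).1 = (e x).1 <;> simp [h]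
  rw [this]
  split_ifs <;> simp [entry_eq]

theorem snd_put_of_comm (e₁ : X ≃ γ₁ × α₁) (e₂ : X ≃ γ₂ × α₂)
    (h : ∀ x a b, put e₁ (put e₂ x b) a = put e₂ (put e₁ x a) b) (x : X) (b : α₂) :
    (e₁ (put e₂ x b)).2 = (e₁ x).2 := by
  have h1 : put e₁ x (e₁ x).2 = x := by simp [put]
  have h2 := h x (e₁ x).2 b
  rw [h1, put_eq_iff] at h2
  exact h2.2.symm

open Classical in
-- On a basis vector, the slice of `act e₂ T (ket x)` that `S` sees is a multiple of a single basis
-- vector, so the entry factorizes. The formula is symmetric in the two factors, which is what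
-- `act_commute` exploits.
theorem entry_act_mul_act (e₁ : X ≃ γ₁ × α₁) (e₂ : X ≃ γ₂ × α₂)
    (h : ∀ x a b, put e₁ (put e₂ x b) a = put e₂ (put e₁ x a) b)
    (S : HSpace α₁ →L[ℂ] HSpace α₁) (T : HSpace α₂ →L[ℂ] HSpace α₂) (z x : X) :
    entry (act e₁ S * act e₂ T) z x =
      if put e₁ (put e₂ z (e₂ x).2) (e₁ x).2 = x then
        entry S (e₁ z).2 (e₁ x).2 * entry T (e₂ z).2 (e₂ x).2 else 0 := by
  rw [entry_eq, mul_apply_eq_comp, act_apply]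
  have : slice e₁ (act e₂ T (ket x)) (e₁ z).1 =
      (if put e₁ (put e₂ z (e₂ x).2) (e₁ x).2 = x then entry T (e₂ z).2 (e₂ x).2 else 0) •
        ket (e₁ x).2 := by
    ext a
    rw [slice_apply_put, ← entry_eq, entry_act, ← h,
      snd_put_of_comm e₂ e₁ fun x a b => (h x b a).symm]
    simp only [lp.coeFn_smul, Pi.smul_apply, ket_apply, smul_eq_mul, put_eq_iff e₁]
    by_cases h' : (e₁ (put e₂ z (e₂ x).2)).1 = (e₁ x).1 <;> by_cases h'' : a = (e₁ x).2 <;>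
      simp [h', h'']
  rw [this]
  split_ifs <;> simp [entry_eq, mul_comm]

theorem act_commute (e₁ : X ≃ γ₁ × α₁) (e₂ : X ≃ γ₂ × α₂)
    (h : ∀ x a b, put e₁ (put e₂ x b) a = put e₂ (put e₁ x a) b)
    (S : HSpace α₁ →L[ℂ] HSpace α₁) (T : HSpace α₂ →L[ℂ] HSpace α₂) :
    Commute (act e₁ S) (act e₂ T) := by
  refine clm_ext_entry fun z x => ?_
  rw [entry_act_mul_act e₁ e₂ h, entry_act_mul_act e₂ e₁ fun x a b => (h x b a).symm, h, mul_comm]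

end Commute

/-! ### Local operators of the parties and of the group, and their products. -/

section Sites

variable {ι : Type} {α : ι → Type u} {δ π : Type u}

/-- The splitting of a label into the label of the group and all other labels. -/
def groupEquiv : (∀ j, α j) × δ × π ≃ ((∀ j, α j) × π) × δ where
  toFun x := ((x.1, x.2.2), x.2.1)
  invFun p := (p.1.1, p.2, p.1.2)
  left_inv _ := rfl
  right_inv _ := rfl

@[simp]
theorem groupEquiv_snd (x : (∀ j, α j) × δ × π) : (groupEquiv x).2 = x.2.1 := rfl

@[simp]
theorem put_groupEquiv (x : (∀ j, α j) × δ × π) (a : δ) :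
    put groupEquiv x a = (x.1, a, x.2.2) := rfl

variable [DecidableEq ι]

/-- The splitting of a label into the label of the party `i` and all other labels. -/
def siteEquiv (i : ι) :
    (∀ j, α j) × δ × π ≃ ((∀ j : {j // j ≠ i}, α j) × δ × π) × α i where
  toFun x := ((fun j => x.1 j, x.2), x.1 i)
  invFun p := ((Equiv.piSplitAt i α).symm (p.2, p.1.1), p.1.2)
  left_inv x := Prod.ext ((Equiv.piSplitAt i α).symm_apply_apply x.1) rfl
  right_inv p := by
    have h := (Equiv.piSplitAt i α).apply_symm_apply (p.2, p.1.1)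
    exact Prod.ext (Prod.ext (congrArg Prod.snd h) rfl) (congrArg Prod.fst h)

@[simp]
theorem siteEquiv_snd (i : ι) (x : (∀ j, α j) × δ × π) : (siteEquiv i x).2 = x.1 i := rfl

@[simp]
theorem put_siteEquiv (i : ι) (x : (∀ j, α j) × δ × π) (a : α i) :
    put (siteEquiv i) x a = (Function.update x.1 i a, x.2) := by
  rw [put_eq_iff]
  simp only [siteEquiv, Equiv.coe_fn_mk, Function.update_self, and_true]
  refine Prod.ext (funext fun j => ?_) rfl
  simp [Function.update_of_ne j.2]

/-- The operator of the party `i`, acting on the whole system. -/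
abbrev onSite (δ π : Type u) (i : ι) :
    (HSpace (α i) →L[ℂ] HSpace (α i)) →⋆ₐ[ℂ]
      (HSpace ((∀ j, α j) × δ × π) →L[ℂ] HSpace ((∀ j, α j) × δ × π)) :=
  act (siteEquiv i)

/-- The operator of the group, acting on the whole system. -/
abbrev onGroup (α : ι → Type u) (π : Type u) :
    (HSpace δ →L[ℂ] HSpace δ) →⋆ₐ[ℂ]
      (HSpace ((∀ j, α j) × δ × π) →L[ℂ] HSpace ((∀ j, α j) × δ × π)) :=
  act groupEquiv

theorem onSite_commute {i j : ι} (hij : i ≠ j) (S : HSpace (α i) →L[ℂ] HSpace (α i))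
    (T : HSpace (α j) →L[ℂ] HSpace (α j)) : Commute (onSite δ π i S) (onSite δ π j T) :=
  act_commute _ _ (fun x a b => by simp [Function.update_comm hij]) S T

theorem onSite_commute_onGroup (i : ι) (S : HSpace (α i) →L[ℂ] HSpace (α i))
    (T : HSpace δ →L[ℂ] HSpace δ) : Commute (onSite δ π i S) (onGroup α π T) :=
  act_commute _ _ (fun x a b => by simp) S T

theorem pairwise_onSite (δ π : Type u) : Pairwise fun i j : ι =>
    ∀ (S : HSpace (α i) →L[ℂ] HSpace (α i)) (T : HSpace (α j) →L[ℂ] HSpace (α j)),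
      Commute (MonoidHomClass.toMonoidHom (onSite δ π i) S)
        (MonoidHomClass.toMonoidHom (onSite δ π j) T) :=
  fun _ _ hij S T => onSite_commute hij S T

theorem onSite_pairwise (A : ∀ i, HSpace (α i) →L[ℂ] HSpace (α i)) (s : Finset ι) :
    (s : Set ι).Pairwise (Function.onFun Commute fun i => onSite δ π i (A i)) :=
  fun _ _ _ _ hij => onSite_commute hij _ _

open Classical in
-- Induction on the set of parties acted upon; the parties outside it must keep their labels. The
-- row `z` is generalized because inserting a party changes its label there.
theorem entry_noncommProd_mul (s : Finset ι) (A : ∀ i, HSpace (α i) →L[ℂ] HSpace (α i))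
    (B : HSpace δ →L[ℂ] HSpace δ) (z x : (∀ j, α j) × δ × π) :
    entry (s.noncommProd (fun i => onSite δ π i (A i))
      (onSite_pairwise A _) * onGroup α π B) z x =
      if (∀ j ∉ s, z.1 j = x.1 j) ∧ z.2.2 = x.2.2 then
        (∏ i ∈ s, entry (A i) (z.1 i) (x.1 i)) * entry B z.2.1 x.2.1 else 0 := by
  induction s using Finset.induction_on generalizing z with
  | empty =>
    rw [Finset.noncommProd_empty, one_mul, entry_act]
    simp [Prod.ext_iff, funext_iff]
  | insert i s hi ih =>
    rw [Finset.noncommProd_insert_of_notMem _ _ _ _ hi, mul_assoc, entry_eq,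
      mul_apply_eq_comp, act_apply]
    set G := s.noncommProd (fun i => onSite δ π i (A i))
      (onSite_pairwise A _) * onGroup α π B
    have hs : slice (siteEquiv i) (G (ket x)) (siteEquiv i z).1 =
        (if (∀ j ∉ insert i s, z.1 j = x.1 j) ∧ z.2.2 = x.2.2 then
          (∏ i ∈ s, entry (A i) (z.1 i) (x.1 i)) * entry B z.2.1 x.2.1 else 0) •
            ket (x.1 i) := by
      ext a
      rw [slice_apply_put, ← entry_eq, ih, put_siteEquiv]
      have h1 : ∏ j ∈ s, entry (A j) (Function.update z.1 i a j) (x.1 j) =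
          ∏ j ∈ s, entry (A j) (z.1 j) (x.1 j) := by
        refine Finset.prod_congr rfl fun j hj => ?_
        rw [Function.update_of_ne]
        rintro rfl; exact hi hj
      have h2 : (∀ j ∉ s, Function.update z.1 i a j = x.1 j) ↔
          a = x.1 i ∧ ∀ j ∉ insert i s, z.1 j = x.1 j := by
        constructor
        · intro h
          refine ⟨by simpa using h i hi, fun j hj => ?_⟩
          rw [Finset.mem_insert, not_or] at hj
          simpa [Function.update_of_ne hj.1] using h j hj.2
        · rintro ⟨h, h'⟩ j hj
          by_cases hji : j = i
          · subst hji; simpa using h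
          · rw [Function.update_of_ne hji]
            exact h' j (by simp [hji, hj])
      simp only [h1, h2, lp.coeFn_smul, Pi.smul_apply, ket_apply, smul_eq_mul]
      by_cases ha : a = x.1 i <;> simp [ha]
    rw [hs, Finset.prod_insert hi]
    split_ifs with h
    · simp [entry_eq]; ring
    · simp

variable [Fintype ι]

/-- The product of operators of the individual parties. -/
def honestProd (δ π : Type u) : (∀ i, HSpace (α i) →L[ℂ] HSpace (α i)) →*
    (HSpace ((∀ j, α j) × δ × π) →L[ℂ] HSpace ((∀ j, α j) × δ × π)) :=
  MonoidHom.noncommPiCoprod (fun i => MonoidHomClass.toMonoidHom (onSite δ π i))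
    (pairwise_onSite δ π)

theorem honestProd_eq (A : ∀ i, HSpace (α i) →L[ℂ] HSpace (α i)) :
    honestProd δ π A = Finset.univ.noncommProd (fun i => onSite δ π i (A i))
      (onSite_pairwise A _) :=
  MonoidHom.noncommPiCoprod_apply (hcomm := pairwise_onSite δ π) _ A

/-- The tensor product of operators of the individual parties and of the group. -/
def tensorOp (π : Type u) (A : ∀ i, HSpace (α i) →L[ℂ] HSpace (α i)) (B : HSpace δ →L[ℂ] HSpace δ) :
    HSpace ((∀ j, α j) × δ × π) →L[ℂ] HSpace ((∀ j, α j) × δ × π) :=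
  honestProd δ π A * onGroup α π B

open Classical in
theorem entry_tensorOp (A : ∀ i, HSpace (α i) →L[ℂ] HSpace (α i)) (B : HSpace δ →L[ℂ] HSpace δ)
    (z x : (∀ j, α j) × δ × π) :
    entry (tensorOp π A B) z x = if z.2.2 = x.2.2 then
      (∏ i, entry (A i) (z.1 i) (x.1 i)) * entry B z.2.1 x.2.1 else 0 := by
  rw [tensorOp, honestProd_eq, entry_noncommProd_mul]
  simp

/-- Entries of `tensorOp` vanish unless the purifier labels agree, so the row sum lives on the image
of an injection. This also shows that the `tsum` in `tensorApply` is a true sum, not a default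
value. -/
theorem hasSum_tensorApply (A : ∀ i, HSpace (α i) →L[ℂ] HSpace (α i))
    (B : HSpace δ →L[ℂ] HSpace δ) (ψ : HSpace ((∀ j, α j) × δ × π)) (z : (∀ j, α j) × δ × π) :
    HasSum (fun y : (∀ j, α j) × δ =>
      (∏ i, entry (A i) (z.1 i) (y.1 i)) * entry B z.2.1 y.2 * ψ (y.1, y.2, z.2.2))
      (tensorOp π A B ψ z) := by
  classical
  have h := hasSum_entry (tensorOp π A B) ψ z
  have hinj : Function.Injective
      fun y : (∀ j, α j) × δ => ((y.1, y.2, z.2.2) : (∀ j, α j) × δ × π) := by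
    rintro ⟨a, b⟩ ⟨c, d⟩ h
    simpa using h
  rw [← hinj.hasSum_iff] at h
  · simpa [Function.comp_def, entry_tensorOp] using h
  · rintro ⟨a, b, c⟩ hx
    rw [entry_tensorOp, if_neg, zero_mul]
    rintro rfl
    exact hx ⟨(a, b), rfl⟩

theorem tensorApply_eq (A : ∀ i, HSpace (α i) →L[ℂ] HSpace (α i)) (B : HSpace δ →L[ℂ] HSpace δ)
    (ψ : HSpace ((∀ j, α j) × δ × π)) (z : (∀ j, α j) × δ × π) :
    tensorApply A B ψ z = tensorOp π A B ψ z :=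
  (hasSum_tensorApply A B ψ z).tsum_eq

end Sites

/-! ### Algebra of product operators and their action on a vector. -/

section TensorOp

variable {ι : Type} [Fintype ι] [DecidableEq ι] {α : ι → Type u} {δ π : Type u}

theorem honestProd_mulSingle (i : ι) (S : HSpace (α i) →L[ℂ] HSpace (α i)) :
    honestProd δ π (Pi.mulSingle i S) = onSite δ π i S :=
  MonoidHom.noncommPiCoprod_mulSingle (hcomm := pairwise_onSite δ π) _ i S

theorem honestProd_eq_mul_onSite (A : ∀ i, HSpace (α i) →L[ℂ] HSpace (α i)) (i : ι) :
    honestProd δ π A = honestProd δ π (Function.update A i 1) * onSite δ π i (A i) := by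
  rw [← honestProd_mulSingle, ← map_mul]
  congr 1
  ext1 j
  by_cases h : j = i
  · subst h; simp
  · simp [h]

theorem honestProd_commute_onSite (A : ∀ i, HSpace (α i) →L[ℂ] HSpace (α i)) (i : ι)
    (hA : A i = 1) (S : HSpace (α i) →L[ℂ] HSpace (α i)) :
    Commute (honestProd δ π A) (onSite δ π i S) := by
  rw [← honestProd_mulSingle]
  refine Commute.map ?_ _
  ext1 j
  by_cases h : j = i
  · subst h; simp [hA]
  · simp [h]

theorem honestProd_commute_onGroup (A : ∀ i, HSpace (α i) →L[ℂ] HSpace (α i))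
    (T : HSpace δ →L[ℂ] HSpace δ) : Commute (honestProd δ π A) (onGroup α π T) := by
  rw [honestProd_eq]
  exact (Finset.noncommProd_commute _ _ _ _ fun i _ => (onSite_commute_onGroup i _ T).symm).symm

theorem honestProd_apply_eq_self {A : ∀ i, HSpace (α i) →L[ℂ] HSpace (α i)}
    {ξ : HSpace ((∀ j, α j) × δ × π)} (h : ∀ i, onSite δ π i (A i) ξ = ξ) :
    honestProd δ π A ξ = ξ := by
  rw [honestProd_eq]
  refine Finset.noncommProd_induction _ _ _ (fun T : HSpace _ →L[ℂ] HSpace _ => T ξ = ξ)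
    (fun S T hS hT => ?_) rfl
    fun i _ => h i
  rw [mul_apply_eq_comp, hT, hS]

/-- Since factors of different parties commute, each can be moved next to the vector, exchanged
there, and moved back. -/
theorem honestProd_apply_congr {A A' : ∀ i, HSpace (α i) →L[ℂ] HSpace (α i)}
    {ξ : HSpace ((∀ j, α j) × δ × π)}
    (h : ∀ i, onSite δ π i (A i) ξ = onSite δ π i (A' i) ξ) :
    honestProd δ π A ξ = honestProd δ π A' ξ := by
  suffices H : ∀ s : Finset ι, s.noncommProd _ (onSite_pairwise (δ := δ) (π := π) A s) ξ =
      s.noncommProd _ (onSite_pairwise A' s) ξ by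
    simpa only [honestProd_eq] using H Finset.univ
  intro s
  induction s using Finset.induction_on with
  | empty => rfl
  | insert i s hi ih =>
    have hc : Commute (onSite δ π i (A i))
        (s.noncommProd _ (onSite_pairwise (δ := δ) (π := π) A' s)) :=
      Finset.noncommProd_commute _ _ _ _ fun j hj =>
        onSite_commute (by rintro rfl; exact hi hj) _ _
    rw [Finset.noncommProd_insert_of_notMem _ _ _ _ hi, mul_apply_eq_comp, ih,
      Finset.noncommProd_insert_of_notMem' _ _ _ _ hi, mul_apply_eq_comp, ← h i,
      ← mul_apply_eq_comp, hc.eq, mul_apply_eq_comp]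

theorem norm_mul_le_one {R : Type*} [SeminormedRing R] {a b : R} (ha : ‖a‖ ≤ 1) (hb : ‖b‖ ≤ 1) :
    ‖a * b‖ ≤ 1 :=
  (norm_mul_le a b).trans (mul_le_one₀ ha (norm_nonneg _) hb)

theorem norm_honestProd_le_one {A : ∀ i, HSpace (α i) →L[ℂ] HSpace (α i)}
    (h : ∀ i, ‖A i‖ ≤ 1) : ‖honestProd δ π A‖ ≤ 1 := by
  rw [honestProd_eq]
  exact Finset.noncommProd_induction _ _ _ (fun T => ‖T‖ ≤ 1)
    (fun S T hS hT => norm_mul_le_one hS hT)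
    ContinuousLinearMap.norm_id_le fun i _ => (norm_act_le _ _).trans (h i)

theorem norm_tensorOp_le_one {A : ∀ i, HSpace (α i) →L[ℂ] HSpace (α i)}
    {B : HSpace δ →L[ℂ] HSpace δ} (h : ∀ i, ‖A i‖ ≤ 1) (hB : ‖B‖ ≤ 1) : ‖tensorOp π A B‖ ≤ 1 :=
  norm_mul_le_one (norm_honestProd_le_one h) ((norm_act_le _ _).trans hB)

theorem tensorOp_mul (A A' : ∀ i, HSpace (α i) →L[ℂ] HSpace (α i))
    (B B' : HSpace δ →L[ℂ] HSpace δ) :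
    tensorOp π (A * A') (B * B') = tensorOp π A B * tensorOp π A' B' := by
  rw [tensorOp, map_mul, map_mul, tensorOp, tensorOp,
    (honestProd_commute_onGroup A' B).symm.mul_mul_mul_comm]

theorem tensorOp_one (A : ∀ i, HSpace (α i) →L[ℂ] HSpace (α i)) :
    tensorOp π A (1 : HSpace δ →L[ℂ] HSpace δ) = honestProd δ π A := by
  rw [tensorOp, map_one, mul_one]

theorem tensorOp_eq_onSite_mul (A : ∀ i, HSpace (α i) →L[ℂ] HSpace (α i))
    (B : HSpace δ →L[ℂ] HSpace δ) (i : ι) :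
    tensorOp π A B = onSite δ π i (A i) * tensorOp π (Function.update A i 1) B := by
  rw [tensorOp, tensorOp, ← mul_assoc, honestProd_eq_mul_onSite A i,
    (honestProd_commute_onSite _ i (by simp) _).eq]

theorem tensorOp_commute_onSite (A : ∀ i, HSpace (α i) →L[ℂ] HSpace (α i))
    (B : HSpace δ →L[ℂ] HSpace δ) (i : ι) (hA : A i = 1) (S : HSpace (α i) →L[ℂ] HSpace (α i)) :
    Commute (tensorOp π A B) (onSite δ π i S) :=
  (honestProd_commute_onSite A i hA S).mul_left (onSite_commute_onGroup i S B).symm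

theorem tensorOp_apply_eq_self {A : ∀ i, HSpace (α i) →L[ℂ] HSpace (α i)}
    {B : HSpace δ →L[ℂ] HSpace δ} {ξ : HSpace ((∀ j, α j) × δ × π)}
    (h : ∀ i, onSite δ π i (A i) ξ = ξ) (hB : onGroup α π B ξ = ξ) : tensorOp π A B ξ = ξ := by
  rw [tensorOp, mul_apply_eq_comp, hB, honestProd_apply_eq_self h]

/-- One factor turns `ψ` into `φ`; every `P j` fixes `φ`, being idempotent with `φ` in its image. -/
theorem honestProd_apply_of_idempotent [Nonempty ι] {P : ∀ i, HSpace (α i) →L[ℂ] HSpace (α i)}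
    {ψ φ : HSpace ((∀ j, α j) × δ × π)} (hP : ∀ i, P i * P i = P i)
    (h : ∀ i, onSite δ π i (P i) ψ = φ) : honestProd δ π P ψ = φ := by
  obtain ⟨i⟩ := ‹Nonempty ι›
  have h1 : honestProd δ π P ψ = honestProd δ π P φ := by
    rw [← h i, honestProd_eq_mul_onSite P i, mul_apply_eq_comp, mul_apply_eq_comp,
      ← mul_apply_eq_comp (onSite δ π i (P i)), ← map_mul, hP]
  rw [h1]
  refine honestProd_apply_eq_self fun j => ?_
  rw [← h j, ← mul_apply_eq_comp, ← map_mul, hP]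

/-- The components of the isometry `v ↦ |0⟩ ⊗ (1 - P) v + |1⟩ ⊗ X P v`. -/
def swapOp {α : Type u} (P X : HSpace α →L[ℂ] HSpace α) (t : Fin 2) : HSpace α →L[ℂ] HSpace α :=
  if t = 0 then 1 - P else X * P

theorem honestProd_swapOp_apply [Nonempty ι] {P X : ∀ i, HSpace (α i) →L[ℂ] HSpace (α i)}
    {ψ φ : HSpace ((∀ j, α j) × δ × π)} (hP : ∀ i, P i * P i = P i)
    (h : ∀ i, onSite δ π i (P i) ψ = φ) (τ : ι → Fin 2) :
    honestProd δ π (fun i => swapOp (P i) (X i) (τ i)) ψ =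
      if ∀ i, τ i = 0 then ψ - φ else if ∀ i, τ i = 1 then honestProd δ π X φ else 0 := by
  have h' : ∀ i, onSite δ π i (1 - P i) ψ = ψ - φ := fun i => by simp [h i]
  split_ifs with h0 h1
  · simp only [h0, swapOp, if_true]
    exact honestProd_apply_of_idempotent
      (fun i => by rw [mul_sub, sub_mul, sub_mul, hP]; simp) h'
  · have : (fun i => swapOp (P i) (X i) (τ i)) = X * P := by
      ext1 i; simp [swapOp, h1]
    rw [this, map_mul, mul_apply_eq_comp, honestProd_apply_of_idempotent hP h]
  -- A mixed string has a factor `1 - P i` and a factor ending in `P j`. As `ψ - φ` is also the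
  -- image of `ψ` under `1 - P j`, the product contains `P j * (1 - P j) = 0`.
  · push Not at h0 h1
    obtain ⟨j, hj⟩ := h0
    obtain ⟨i, hi⟩ := h1
    have hi : τ i = 0 := by omega
    have hij : j ≠ i := by rintro rfl; exact hj hi
    rw [honestProd_eq_mul_onSite _ i, honestProd_eq_mul_onSite _ j, mul_apply_eq_comp,
      mul_apply_eq_comp, Function.update_of_ne hij]
    simp only [swapOp, hi, hj, if_true, if_false]
    rw [h' i, ← h' j, ← mul_apply_eq_comp (onSite δ π j _), ← map_mul, mul_assoc, mul_sub, hP]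
    simp

end TensorOp

/-! ### The CHSH inequality with its equality case, and facts on contractions. -/

section Hilbert

variable {E : Type*} [NormedAddCommGroup E] [InnerProductSpace ℂ E]

theorem norm_sqrt_two_smul_sub_sq (r u v : E) {s t : ℝ} (hs : s ^ 2 = 1) (ht : t ^ 2 = 1) :
    ‖(√2 : ℂ) • r - ((s : ℂ) • u + (t : ℂ) • v)‖ ^ 2 =
      2 * ‖r‖ ^ 2 + ‖u‖ ^ 2 + ‖v‖ ^ 2 + 2 * (s * t) * (inner ℂ u v).re
        - 2 * √2 * (s * (inner ℂ u r).re + t * (inner ℂ v r).re) := by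
  have hn : ∀ (c : ℝ) (x : E), ‖(c : ℂ) • x‖ ^ 2 = c ^ 2 * ‖x‖ ^ 2 := fun c x => by
    rw [norm_smul, mul_pow, Complex.norm_real, Real.norm_eq_abs, sq_abs]
  rw [@norm_sub_sq ℂ, @norm_add_sq ℂ, hn, hn, hn, hs, ht, Real.sq_sqrt (by norm_num)]
  simp only [inner_smul_left, inner_smul_right, inner_add_right, Complex.conj_ofReal,
    RCLike.re_to_complex, Complex.re_ofReal_mul, Complex.add_re]
  have h1 : (inner ℂ r u).re = (inner ℂ u r).re := inner_re_symm (𝕜 := ℂ) r u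
  have h2 : (inner ℂ r v).re = (inner ℂ v r).re := inner_re_symm (𝕜 := ℂ) r v
  rw [h1, h2]
  ring

/-- A sum-of-squares certificate of Tsirelson's bound: the sign condition cancels the cross terms
`inner ℂ u₀ u₁` of the two squares. Only vectors occur, so `r₀` and `r₁` may come from products over
many systems. -/
theorem chsh_defect {u₀ u₁ r₀ r₁ : E} {e₁ e₂ e₃ e₄ : ℝ} (h₁ : e₁ ^ 2 = 1) (h₂ : e₂ ^ 2 = 1)
    (h₃ : e₃ ^ 2 = 1) (h₄ : e₄ ^ 2 = 1) (h : e₁ * e₂ = -(e₃ * e₄)) :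
    2 * √2 * (e₁ * (inner ℂ u₀ r₀).re + e₂ * (inner ℂ u₁ r₀).re + e₃ * (inner ℂ u₀ r₁).re
      + e₄ * (inner ℂ u₁ r₁).re) =
    2 * (‖u₀‖ ^ 2 + ‖u₁‖ ^ 2 + ‖r₀‖ ^ 2 + ‖r₁‖ ^ 2)
      - ‖(√2 : ℂ) • r₀ - ((e₁ : ℂ) • u₀ + (e₂ : ℂ) • u₁)‖ ^ 2
      - ‖(√2 : ℂ) • r₁ - ((e₃ : ℂ) • u₀ + (e₄ : ℂ) • u₁)‖ ^ 2 := by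
  rw [norm_sqrt_two_smul_sub_sq _ _ _ h₁ h₂, norm_sqrt_two_smul_sub_sq _ _ _ h₃ h₄, h]
  ring

theorem chsh_le {u₀ u₁ r₀ r₁ : E} {e₁ e₂ e₃ e₄ : ℝ} (h₁ : e₁ ^ 2 = 1) (h₂ : e₂ ^ 2 = 1)
    (h₃ : e₃ ^ 2 = 1) (h₄ : e₄ ^ 2 = 1) (h : e₁ * e₂ = -(e₃ * e₄))
    (hu₀ : ‖u₀‖ ≤ 1) (hu₁ : ‖u₁‖ ≤ 1) (hr₀ : ‖r₀‖ ≤ 1) (hr₁ : ‖r₁‖ ≤ 1) :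
    e₁ * (inner ℂ u₀ r₀).re + e₂ * (inner ℂ u₁ r₀).re + e₃ * (inner ℂ u₀ r₁).re
      + e₄ * (inner ℂ u₁ r₁).re ≤ 2 * √2 := by
  have key := chsh_defect (u₀ := u₀) (u₁ := u₁) (r₀ := r₀) (r₁ := r₁) h₁ h₂ h₃ h₄ h
  have hs : 0 < √2 := by positivity
  have hs2 : √2 * √2 = 2 := Real.mul_self_sqrt (by norm_num)
  have a := pow_le_one₀ (n := 2) (norm_nonneg _) hu₀
  have b := pow_le_one₀ (n := 2) (norm_nonneg _) hu₁
  have c := pow_le_one₀ (n := 2) (norm_nonneg _) hr₀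
  have d := pow_le_one₀ (n := 2) (norm_nonneg _) hr₁
  refine le_of_mul_le_mul_left ?_ (by positivity : 0 < 2 * √2)
  rw [key]
  have f := sq_nonneg ‖(√2 : ℂ) • r₀ - ((e₁ : ℂ) • u₀ + (e₂ : ℂ) • u₁)‖
  have g := sq_nonneg ‖(√2 : ℂ) • r₁ - ((e₃ : ℂ) • u₀ + (e₄ : ℂ) • u₁)‖
  linarith

theorem chsh_eq {u₀ u₁ r₀ r₁ : E} {e₁ e₂ e₃ e₄ : ℝ} (h₁ : e₁ ^ 2 = 1) (h₂ : e₂ ^ 2 = 1)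
    (h₃ : e₃ ^ 2 = 1) (h₄ : e₄ ^ 2 = 1) (h : e₁ * e₂ = -(e₃ * e₄))
    (hu₀ : ‖u₀‖ ≤ 1) (hu₁ : ‖u₁‖ ≤ 1) (hr₀ : ‖r₀‖ ≤ 1) (hr₁ : ‖r₁‖ ≤ 1)
    (heq : e₁ * (inner ℂ u₀ r₀).re + e₂ * (inner ℂ u₁ r₀).re + e₃ * (inner ℂ u₀ r₁).re
      + e₄ * (inner ℂ u₁ r₁).re = 2 * √2) :
    ‖u₀‖ = 1 ∧ ‖u₁‖ = 1 ∧ ‖r₀‖ = 1 ∧ ‖r₁‖ = 1 ∧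
      (√2 : ℂ) • r₀ = (e₁ : ℂ) • u₀ + (e₂ : ℂ) • u₁ ∧
      (√2 : ℂ) • r₁ = (e₃ : ℂ) • u₀ + (e₄ : ℂ) • u₁ := by
  have key := chsh_defect (u₀ := u₀) (u₁ := u₁) (r₀ := r₀) (r₁ := r₁) h₁ h₂ h₃ h₄ h
  have hs2 : √2 * √2 = 2 := Real.mul_self_sqrt (by norm_num)
  rw [heq] at key
  have a := pow_le_one₀ (n := 2) (norm_nonneg _) hu₀
  have b := pow_le_one₀ (n := 2) (norm_nonneg _) hu₁
  have c := pow_le_one₀ (n := 2) (norm_nonneg _) hr₀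
  have d := pow_le_one₀ (n := 2) (norm_nonneg _) hr₁
  have f := sq_nonneg ‖(√2 : ℂ) • r₀ - ((e₁ : ℂ) • u₀ + (e₂ : ℂ) • u₁)‖
  have g := sq_nonneg ‖(√2 : ℂ) • r₁ - ((e₃ : ℂ) • u₀ + (e₄ : ℂ) • u₁)‖
  have one : ∀ {v : E}, 1 ≤ ‖v‖ ^ 2 → ‖v‖ ≤ 1 → ‖v‖ = 1 := fun {v} hv hv' =>
    le_antisymm hv' ((one_le_sq_iff₀ (norm_nonneg _)).1 hv)
  have zero : ∀ {v w : E}, ‖v - w‖ ^ 2 ≤ 0 → v = w := fun {v w} hv => by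
    rw [← sub_eq_zero, ← norm_eq_zero, ← sq_eq_zero_iff]
    exact le_antisymm hv (sq_nonneg _)
  refine ⟨one ?_ hu₀, one ?_ hu₁, one ?_ hr₀, one ?_ hr₁, zero ?_, zero ?_⟩ <;> linarith

/-- The quadratic form of `1 + A` at `(1 - A) v` plus that of `1 - A` at `(1 + A) v` equals `2 (‖v‖²
- ‖A v‖²)`. -/
theorem norm_le_one_of_isPositive {A : E →L[ℂ] E} (h₁ : (1 - A).IsPositive)
    (h₂ : (1 + A).IsPositive) : ‖A‖ ≤ 1 := by
  refine ContinuousLinearMap.opNorm_le_bound _ zero_le_one fun v => ?_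
  have hA : ∀ x y, inner ℂ (A x) y = inner ℂ x (A y) := fun x y => by
    have := h₂.isSymmetric x y
    simpa [inner_add_left, inner_add_right] using this
  have k1 := h₂.re_inner_nonneg_left ((1 - A) v)
  have k2 := h₁.re_inner_nonneg_left ((1 + A) v)
  have hr : (inner ℂ (A v) v).re = (inner ℂ v (A v)).re := inner_re_symm (𝕜 := ℂ) _ _
  have hAA : (inner ℂ v (A (A v))).re = ‖A v‖ ^ 2 := by
    rw [← hA, ← inner_self_eq_norm_sq (𝕜 := ℂ)]; rfl
  have hAAA : (inner ℂ (A v) (A (A v))).re = (inner ℂ (A (A v)) (A v)).re :=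
    inner_re_symm (𝕜 := ℂ) _ _
  have hvv : (inner ℂ v v).re = ‖v‖ ^ 2 := inner_self_eq_norm_sq (𝕜 := ℂ) v
  have hvv' : (inner ℂ (A v) (A v)).re = ‖A v‖ ^ 2 := inner_self_eq_norm_sq (𝕜 := ℂ) _
  simp only [add_apply, sub_apply, one_apply_eq_self, map_sub, map_add, inner_add_left,
    inner_add_right, inner_sub_left, inner_sub_right, RCLike.re_to_complex,
    hvv, hvv', hA (A v) v] at k1 k2
  rw [one_mul]
  refine (pow_le_pow_iff_left₀ (norm_nonneg _) (norm_nonneg _) two_ne_zero).1 ?_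
  have := hA v v
  have := hA v (A v)
  have := hA (A v) v
  simp only [*] at *
  linarith

variable [CompleteSpace E]

/-- Expanding, `‖A (A v) - v‖² = ‖A (A v)‖² - 2 ‖A v‖² + ‖v‖² ≤ 0`. Thus observables of POVMs that
are not assumed projective still square to one on the state. -/
theorem apply_apply_eq_self_of_norm_eq {A : E →L[ℂ] E} (hA : star A = A) (hA1 : ‖A‖ ≤ 1) {v : E}
    (h : ‖A v‖ = ‖v‖) : A (A v) = v := by
  have h1 : inner ℂ (A (A v)) v = inner ℂ (A v) (A v) := by
    nth_rewrite 1 [← hA]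
    rw [ContinuousLinearMap.star_eq_adjoint, ContinuousLinearMap.adjoint_inner_left]
  have h2 : ‖A (A v)‖ ≤ ‖v‖ := by
    have := A.le_of_opNorm_le hA1 (A v)
    rwa [one_mul, h] at this
  rw [← sub_eq_zero, ← norm_eq_zero, ← sq_eq_zero_iff]
  refine le_antisymm ?_ (sq_nonneg _)
  rw [@norm_sub_sq ℂ, h1, inner_self_eq_norm_sq (𝕜 := ℂ), h]
  have := pow_le_pow_left₀ (norm_nonneg _) h2 2
  linarith

theorem norm_apply_eq_of_star_mul_self {A : E →L[ℂ] E} (h : star A * A = 1) (v : E) :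
    ‖A v‖ = ‖v‖ := by
  refine ContinuousLinearMap.norm_map_iff_adjoint_comp_self A |>.2 h v

theorem norm_swap_sq {P X : E →L[ℂ] E} (hP : star P = P) (hPP : P * P = P)
    (hX : star X * X = 1) (v : E) : ‖(1 - P) v‖ ^ 2 + ‖(X * P) v‖ ^ 2 = ‖v‖ ^ 2 := by
  rw [mul_apply_eq_comp, norm_apply_eq_of_star_mul_self hX]
  have h : inner ℂ ((1 - P) v) (P v) = 0 := by
    nth_rewrite 2 [← hP]
    rw [ContinuousLinearMap.star_eq_adjoint, ContinuousLinearMap.adjoint_inner_right,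
      ← mul_apply_eq_comp, mul_sub, hPP]
    simp
  have := norm_add_sq_eq_norm_sq_add_norm_sq_of_inner_eq_zero (𝕜 := ℂ) _ _ h
  simp only [sub_apply, one_apply_eq_self, sub_add_cancel] at this ⊢
  nlinarith

end Hilbert

/-! ### Extraction of a qubit from anticommuting observables. -/

/-- On the range of `E`, `A` and `B` behave like Pauli `X` and `Y`, so `A B` is `i Z` and `(1 + i A
B) / 2` is `|1⟩⟨1|`. Off this range `P` is zero and `X` the identity, which makes `X` a global
isometry; the final `E` in the exchange relation is needed because the exchange fails there. -/
theorem exists_swap_of_relations {R : Type*} [Ring R] [StarRing R] [Algebra ℂ R] [StarModule ℂ R]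
    {A B E : R} (hA : star A = A) (hB : star B = B) (hE : star E = E) (hEE : E * E = E)
    (hEA : E * A = A * E) (hEB : E * B = B * E) (hAAE : A * (A * E) = E) (hBBE : B * (B * E) = E)
    (hBAE : B * (A * E) = -(A * (B * E))) :
    ∃ P X : R, star P = P ∧ P * P = P ∧ star X * X = 1 ∧
      P = (1 / 2 : ℂ) • (E + Complex.I • (A * (B * E))) ∧ X = A * E + (1 - E) ∧
      X * P = (1 - P) * X * E := by
  have hEA' : ∀ Z, E * (A * Z) = A * (E * Z) := fun Z => by rw [← mul_assoc, hEA, mul_assoc]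
  have hEB' : ∀ Z, E * (B * Z) = B * (E * Z) := fun Z => by rw [← mul_assoc, hEB, mul_assoc]
  have hI : ∀ Z : R, Complex.I • Complex.I • Z = -Z := fun Z => by
    rw [smul_smul, Complex.I_mul_I, neg_one_smul]
  have hBAB : B * (A * (B * E)) = -(A * E) := by
    have := congrArg (· * B) hBAE
    simp only [mul_assoc, hEB, neg_mul, hBBE] at this
    exact this
  have hAAB : A * (A * (B * E)) = B * E := by
    have := congrArg (· * B) hAAE
    simp only [mul_assoc, hEB] at this
    exact this
  set J := A * (B * E) with hJ
  have hEJ : E * J = J := by rw [hJ, hEA', hEB', hEE]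
  have hJE : J * E = J := by rw [hJ, mul_assoc, mul_assoc, hEE]
  have hJJ : J * J = -E := by
    rw [hJ, mul_assoc, mul_assoc, hEA', hEB', hEE, hBAB, mul_neg, hAAE]
  have hJA : J * (A * E) = -(B * E) := by
    rw [hJ, mul_assoc, mul_assoc, hEA', hEE, hBAE, mul_neg, hAAB]
  set P := (1 / 2 : ℂ) • (E + Complex.I • J) with hP
  have hXE : (A * E + (1 - E)) * E = A * E := by
    rw [add_mul, sub_mul, mul_assoc, hEE, one_mul, sub_self, add_zero]
  have hEK : E * (A * E) = A * E := by rw [hEA', hEE]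
  have hXP : (A * E + (1 - E)) * P = (1 / 2 : ℂ) • (A * E + Complex.I • (B * E)) := by
    rw [hP, mul_smul_comm, mul_add, mul_smul_comm, add_mul, add_mul, sub_mul, sub_mul, hEE, hEJ,
      mul_assoc, mul_assoc, hEE, hEJ, hAAB]
    simp
  have hPX : (1 - P) * (A * E + (1 - E)) * E = (1 / 2 : ℂ) • (A * E + Complex.I • (B * E)) := by
    rw [mul_assoc, hXE, sub_mul, one_mul, hP, smul_mul_assoc, add_mul, smul_mul_assoc, hJA, hEK]
    module
  refine ⟨P, A * E + (1 - E), ?_, ?_, ?_, hP, rfl, hXP.trans hPX.symm⟩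
  · have : star J = -J := by
      rw [hJ, star_mul, star_mul, hA, hB, hE, hEB, mul_assoc, hEA, hBAE]
    simp [hP, hE, this]
  · rw [hP, smul_mul_smul_comm, add_mul, mul_add, mul_add, hEE, mul_smul_comm, smul_mul_assoc,
      mul_smul_comm, smul_mul_assoc, hEJ, hJE, hJJ, hI]
    module
  · have : star (A * E + (1 - E)) = A * E + (1 - E) := by
      rw [star_add, star_sub, star_one, star_mul, hA, hE, hEA]
    rw [this, mul_add, mul_sub, hXE, mul_one, add_sub_cancel_left, add_mul, sub_mul, hEK, one_mul,
      sub_self, add_zero, mul_assoc, hEK, hAAE, add_sub_cancel]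

section Local

variable {X α γ : Type u}

/-- On `ψ`, `A` and `B` act like `QA` and `QB`, which commute with the whole subsystem. They
therefore preserve the support `E` of the reduced state, and relations on `ψ` become operator
relations after multiplication by `E`. -/
theorem exists_swap (e : X ≃ γ × α) (ψ : HSpace X) {A B : HSpace α →L[ℂ] HSpace α}
    (hA : star A = A) (hB : star B = B) (hAA : act e A (act e A ψ) = ψ)
    (hBB : act e B (act e B ψ) = ψ) (hAB : act e A (act e B ψ) = - act e B (act e A ψ))
    {QA QB : HSpace X →L[ℂ] HSpace X} (hQA : ∀ T, Commute QA (act e T))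
    (hQB : ∀ T, Commute QB (act e T)) (hA' : act e A ψ = QA ψ) (hB' : act e B ψ = QB ψ) :
    ∃ P X : HSpace α →L[ℂ] HSpace α, star P = P ∧ P * P = P ∧ star X * X = 1 ∧
      act e P ψ = (1 / 2 : ℂ) • (ψ + Complex.I • act e A (act e B ψ)) ∧
      act e X ψ = act e A ψ ∧ act e X (act e P ψ) = act e (1 - P) (act e X ψ) := by
  obtain ⟨E, hE, hEE, hEψ, hsupp⟩ := exists_support_projection e ψ
  have hcomm : ∀ {C : HSpace α →L[ℂ] HSpace α} {Q : HSpace X →L[ℂ] HSpace X}, star C = C →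
      (∀ T, Commute Q (act e T)) → act e C ψ = Q ψ → E * C = C * E := by
    intro C Q hC hQ hCQ
    have h1 : (1 - E) * C * E = 0 := by
      refine hsupp _ ?_
      rw [map_mul, mul_apply_eq_comp, hCQ, ← mul_apply_eq_comp, ← (hQ _).eq, mul_apply_eq_comp]
      simp [hEψ]
    have h2 : C * E = E * C * E := by
      rw [← sub_eq_zero, ← h1]; noncomm_ring
    -- `C E = E C E` says that `C` preserves the support; the adjoint gives `E C = E C E`, hence
    -- commutation.
    have h3 := congrArg star h2
    simp only [star_mul, hE, hC] at h3
    rw [h3, ← mul_assoc, ← h2]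
  have hEA := hcomm hA hQA hA'
  have hEB := hcomm hB hQB hB'
  have hAAE : A * (A * E) = E := by
    rw [← mul_assoc, ← sub_eq_zero]
    have := hsupp (A * A - 1) (by simp [hAA])
    rwa [sub_mul, one_mul] at this
  have hBBE : B * (B * E) = E := by
    rw [← mul_assoc, ← sub_eq_zero]
    have := hsupp (B * B - 1) (by simp [hBB])
    rwa [sub_mul, one_mul] at this
  have hBAE : B * (A * E) = -(A * (B * E)) := by
    have := hsupp (A * B + B * A) (by simp [hAB])
    rw [add_mul, mul_assoc, mul_assoc] at this
    rw [eq_neg_iff_add_eq_zero, add_comm, this]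
  obtain ⟨P, X, hP, hPP, hXX, hP', hX', hXP⟩ :=
    exists_swap_of_relations hA hB hE hEE hEA hEB hAAE hBBE hBAE
  refine ⟨P, X, hP, hPP, hXX, ?_, ?_, ?_⟩
  · rw [hP', map_smul, map_add, map_smul, map_mul, map_mul, smul_apply, add_apply, smul_apply,
      mul_apply_eq_comp, mul_apply_eq_comp, hEψ]
  · rw [hX', map_add, map_sub, map_mul, map_one, add_apply, sub_apply, mul_apply_eq_comp, hEψ,
      one_apply_eq_self, sub_self, add_zero]
  · rw [← mul_apply_eq_comp, ← mul_apply_eq_comp, ← map_mul, ← map_mul, hXP, map_mul,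
      mul_apply_eq_comp, hEψ]

end Local

/-! ### Observables of POVMs and multilinear expansion. -/

section POVM

variable {E : Type*} [NormedAddCommGroup E] [InnerProductSpace ℂ E] {J : Type*} [Fintype J]

/-- The observable with value `(-1) ^ n a` on the outcome `a` of a POVM. -/
def signedSum (n : J → ℕ) (Q : J → E →L[ℂ] E) : E →L[ℂ] E := ∑ a, (-1 : ℂ) ^ n a • Q a

variable {n : J → ℕ} {Q : J → E →L[ℂ] E}

theorem star_signedSum [CompleteSpace E] (hQ : ∀ a, (Q a).IsPositive) :
    star (signedSum n Q) = signedSum n Q := by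
  rw [signedSum, star_sum]
  refine Finset.sum_congr rfl fun a _ => ?_
  rw [star_smul, (hQ a).isSelfAdjoint.star_eq]
  simp

theorem norm_signedSum_le_one (hQ : ∀ a, (Q a).IsPositive) (h1 : ∑ a, Q a = 1) :
    ‖signedSum n Q‖ ≤ 1 := by
  refine norm_le_one_of_isPositive ?_ ?_
  · rw [signedSum, ← h1, ← Finset.sum_sub_distrib]
    refine ContinuousLinearMap.isPositive_sum _ fun a _ => ?_
    rcases neg_one_pow_eq_or ℂ (n a) with h | h <;> rw [h]
    · simp
    · rw [neg_one_smul, sub_neg_eq_add]; exact (hQ a).add (hQ a)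
  · rw [signedSum, ← h1, ← Finset.sum_add_distrib]
    refine ContinuousLinearMap.isPositive_sum _ fun a _ => ?_
    rcases neg_one_pow_eq_or ℂ (n a) with h | h <;> rw [h]
    · rw [one_smul]; exact (hQ a).add (hQ a)
    · simp

end POVM

section Multilinear

variable {ι : Type} [Fintype ι] [DecidableEq ι] {α : ι → Type u} {δ π : Type u}

/-- Comparing matrix elements reduces the noncommutative expansion to the distributive law for
products of scalars. -/
theorem tensorOp_sum_smul {J K : Type} [Fintype J] [Fintype K]
    (Q : ∀ i, J → HSpace (α i) →L[ℂ] HSpace (α i)) (Q' : K → HSpace δ →L[ℂ] HSpace δ)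
    (s : J → ℂ) (s' : K → ℂ) :
    tensorOp π (fun i => ∑ t, s t • Q i t) (∑ b, s' b • Q' b) =
      ∑ p : (ι → J) × K, ((∏ i, s (p.1 i)) * s' p.2) •
        tensorOp π (fun i => Q i (p.1 i)) (Q' p.2) := by
  classical
  refine clm_ext_entry fun z x => ?_
  simp only [entry_sum, entry_smul, entry_tensorOp]
  split_ifs
  · rw [Finset.prod_univ_sum, Finset.sum_mul_sum, Fintype.sum_prod_type, Fintype.piFinset_univ]
    refine Finset.sum_congr rfl fun a _ => Finset.sum_congr rfl fun b _ => ?_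
    rw [Finset.prod_mul_distrib]
    ring
  · simp

end Multilinear

/-! ### The Svetlichny expression as an average of CHSH expressions. -/

/-- The sign of the inputs of Hamming weight `w` in the Svetlichny expression. -/
def svSign (w : ℕ) : ℝ := (-1) ^ (w * (w + 1) / 2)

theorem svSign_sq (w : ℕ) : svSign w ^ 2 = 1 := by
  rw [svSign, ← pow_mul, mul_comm, pow_mul]; simp

theorem svSign_add_two (w : ℕ) : svSign (w + 2) = -svSign w := by
  have : (w + 2) * (w + 2 + 1) / 2 = w * (w + 1) / 2 + (2 * (w + 1) + 1) := by
    rw [← Nat.add_mul_div_right _ _ (by norm_num : 0 < 2)]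
    congr 1; ring
  rw [svSign, this, pow_add, pow_succ, pow_mul]
  simp [svSign]

/-- Flipping the input of one party. -/
def flipInput {N : ℕ} (b : Fin N) (x : Fin N → Fin 2) : Fin N → Fin 2 :=
  Function.update x b (x b + 1)

theorem flipInput_involutive {N : ℕ} (b : Fin N) : Function.Involutive (flipInput b) := by
  intro x
  have : ∀ t : Fin 2, t + 1 + 1 = t := by decide
  simp [flipInput, this]

theorem sum_flipInput {N : ℕ} (b : Fin N) (F : (Fin N → Fin 2) → ℝ) :
    ∑ x, F (flipInput b x) = ∑ x, F x :=
  Equiv.sum_comp (flipInput_involutive b).toPerm F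

theorem weight_eq_add {N : ℕ} {v b : Fin N} (hb : b ≠ v) (x : Fin N → Fin 2) :
    weight x = x v + (x b + ∑ j ∈ (Finset.univ.erase v).erase b, (x j : ℕ)) := by
  rw [Finset.add_sum_erase _ (fun j => (x j : ℕ)) (Finset.mem_erase.2 ⟨hb, Finset.mem_univ b⟩),
    Finset.add_sum_erase _ (fun j => (x j : ℕ)) (Finset.mem_univ v)]
  rfl

theorem exists_weight_flipInput {N : ℕ} {v b : Fin N} (hb : b ≠ v) (x : Fin N → Fin 2) :
    ∃ m : ℕ, weight x = x v + x b + m ∧ weight (flipInput v x) = ↑(x v + 1) + x b + m ∧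
      weight (flipInput b x) = x v + ↑(x b + 1) + m ∧
      weight (flipInput v (flipInput b x)) = ↑(x v + 1) + ↑(x b + 1) + m := by
  refine ⟨∑ j ∈ (Finset.univ.erase v).erase b, (x j : ℕ),
    by rw [weight_eq_add hb, ← add_assoc], ?_, ?_, ?_⟩
  all_goals
    rw [weight_eq_add hb, ← add_assoc]
    congr 1
    · simp [flipInput, hb, hb.symm]
    · refine Finset.sum_congr rfl fun j hj => ?_
      rw [Finset.mem_erase, Finset.mem_erase] at hj
      simp [flipInput, hj.1, hj.2.1]

/-- If the remaining parties contribute `m`, the orbit has weights `m`, `m + 1`, `m + 1`, `m + 2`.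
The two middle signs cancel in the product, and raising the weight by two reverses the sign. -/
theorem svSign_flipInput {N : ℕ} {v b : Fin N} (hb : b ≠ v) (x : Fin N → Fin 2) :
    svSign (weight x) * svSign (weight (flipInput v x)) =
      -(svSign (weight (flipInput b x)) * svSign (weight (flipInput v (flipInput b x)))) := by
  obtain ⟨m, h1, h2, h3, h4⟩ := exists_weight_flipInput hb x
  rw [h1, h2, h3, h4]
  have hm := svSign_add_two m
  have two : ∀ t : Fin 2, t = 0 ∨ t = 1 := by decide
  have e0 : 1 + 1 + m = m + 2 := by ring
  rcases two (x v) with hv | hv <;> rcases two (x b) with hb | hb <;> rw [hv, hb] <;>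
    simp [e0, hm, mul_comm]

namespace Strategy

variable {N : ℕ} {H : Finset (Fin N)} (S : Strategy.{u} H)

/-- The observable of an honest party. -/
def obs (i : H) (x : Fin 2) : HSpace (S.honestLabel i) →L[ℂ] HSpace (S.honestLabel i) :=
  signedSum (fun a : Fin 2 => (a : ℕ)) (S.honestPOVM i x)

/-- The parity observable of the dishonest group. -/
def groupObs (x : Dishonest H → Fin 2) : HSpace S.dishonestLabel →L[ℂ] HSpace S.dishonestLabel :=
  signedSum (fun a => ∑ j, (a j : ℕ)) (S.dishonestPOVM x)

theorem star_obs (i : H) (x : Fin 2) : star (S.obs i x) = S.obs i x :=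
  star_signedSum (S.honestPOVM_pos i x)

theorem norm_obs (i : H) (x : Fin 2) : ‖S.obs i x‖ ≤ 1 :=
  norm_signedSum_le_one (S.honestPOVM_pos i x) (S.honestPOVM_sum i x)

theorem star_groupObs (x : Dishonest H → Fin 2) : star (S.groupObs x) = S.groupObs x :=
  star_signedSum (S.dishonestPOVM_pos x)

theorem norm_groupObs (x : Dishonest H → Fin 2) : ‖S.groupObs x‖ ≤ 1 :=
  norm_signedSum_le_one (S.dishonestPOVM_pos x) (S.dishonestPOVM_sum x)

theorem prob_eq (x a : Fin N → Fin 2) :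
    S.prob x a = (inner ℂ S.state (tensorOp S.purifierLabel
      (fun i : H => S.honestPOVM i (x i) (a i))
      (S.dishonestPOVM (fun j => x j) (fun j => a j)) S.state)).re := by
  rw [prob, lp.inner_eq_tsum]
  simp only [tensorApply_eq, RCLike.inner_apply, mul_comm]

theorem correlator_eq (x : Fin N → Fin 2) :
    S.correlator x = (inner ℂ S.state (tensorOp S.purifierLabel
      (fun i : H => S.obs i (x i)) (S.groupObs fun j => x j) S.state)).re := by
  simp only [obs, groupObs, signedSum]
  rw [tensorOp_sum_smul, sum_apply, inner_sum, Complex.re_sum, correlator]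
  refine Fintype.sum_equiv (Equiv.piEquivPiSubtypeProd (· ∈ H) fun _ => Fin 2) _ _ fun a => ?_
  rw [prob_eq, smul_apply, inner_smul_right]
  have : (∏ i : H, (-1 : ℂ) ^ (a i : ℕ)) * (-1) ^ (∑ j : Dishonest H, (a j : ℕ)) =
      (((-1) ^ weight a : ℝ) : ℂ) := by
    rw [Finset.prod_pow_eq_pow_sum, ← pow_add, weight,
      ← Fintype.sum_subtype_add_sum_subtype (· ∈ H) fun i => (a i : ℕ)]
    push_cast
    congr!
  rw [← Complex.re_ofReal_mul, ← this]
  rfl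

variable (v : H)

/-- The operator of all systems other than that of the honest party `v`. -/
def restOp (x : Fin N → Fin 2) :=
  tensorOp S.purifierLabel (Function.update (fun i : H => S.obs i (x i)) v 1)
    (S.groupObs fun j => x j)

theorem norm_restOp (x : Fin N → Fin 2) : ‖S.restOp v x‖ ≤ 1 := by
  refine norm_tensorOp_le_one (fun i => ?_) (S.norm_groupObs _)
  by_cases h : i = v
  · subst h; rw [Function.update_self]; exact ContinuousLinearMap.norm_id_le
  · rw [Function.update_of_ne h]; exact S.norm_obs _ _

theorem restOp_commute_onSite (x : Fin N → Fin 2) (T) :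
    Commute (S.restOp v x) (onSite S.dishonestLabel S.purifierLabel v T) :=
  tensorOp_commute_onSite _ _ v (by simp) T

/-- The honesty of `v` enters here: its input is not part of the joint input of the group. -/
theorem restOp_flipInput_self (x : Fin N → Fin 2) :
    S.restOp v (flipInput v x) = S.restOp v x := by
  rw [restOp, restOp]
  congr 1
  · ext1 i
    by_cases h : i = v
    · subst h; simp
    · rw [Function.update_of_ne h, Function.update_of_ne h, flipInput, Function.update_of_ne]
      exact fun h' => h (Subtype.ext h')
  · congr 1
    ext1 j
    rw [flipInput, Function.update_of_ne]
    rintro h; exact j.2 (h ▸ v.2)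

/-- The state after applying the observable of the honest party `v`. -/
def siteVec (t : Fin 2) := onSite S.dishonestLabel S.purifierLabel v (S.obs v t) S.state

theorem norm_siteVec (t : Fin 2) : ‖S.siteVec v t‖ ≤ 1 := by
  have := ContinuousLinearMap.le_of_opNorm_le _
    ((norm_act_le (siteEquiv v) (S.obs v t)).trans (S.norm_obs v t)) S.state
  rwa [S.norm_state, one_mul] at this

theorem norm_restOp_state (x : Fin N → Fin 2) : ‖S.restOp v x S.state‖ ≤ 1 := by
  have := ContinuousLinearMap.le_of_opNorm_le _ (S.norm_restOp v x) S.state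
  rwa [S.norm_state, one_mul] at this

theorem correlator_eq_inner (x : Fin N → Fin 2) :
    S.correlator x = (inner ℂ (S.siteVec v (x v)) (S.restOp v x S.state)).re := by
  rw [correlator_eq, tensorOp_eq_onSite_mul _ _ v, mul_apply_eq_comp, siteVec]
  rw [← ContinuousLinearMap.adjoint_inner_left, ← ContinuousLinearMap.star_eq_adjoint, ← map_star,
    star_obs]
  rfl

/-- Four terms of the Svetlichny expression (up to the sign `σ`), which form a CHSH expression. -/
def chshTerm (σ : ℝ) (b : Fin N) (x : Fin N → Fin 2) : ℝ :=
  σ * svSign (weight x) * S.correlator x +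
  σ * svSign (weight (flipInput v x)) * S.correlator (flipInput v x) +
  σ * svSign (weight (flipInput b x)) * S.correlator (flipInput b x) +
  σ * svSign (weight (flipInput v (flipInput b x))) * S.correlator (flipInput v (flipInput b x))

theorem chshTerm_eq (σ : ℝ) {b : Fin N} (hb : b ≠ v) (x : Fin N → Fin 2) :
    S.chshTerm v σ b x =
      σ * svSign (weight x) * (inner ℂ (S.siteVec v (x v)) (S.restOp v x S.state)).re +
      σ * svSign (weight (flipInput v x)) *
        (inner ℂ (S.siteVec v (x v + 1)) (S.restOp v x S.state)).re +
      σ * svSign (weight (flipInput b x)) *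
        (inner ℂ (S.siteVec v (x v)) (S.restOp v (flipInput b x) S.state)).re +
      σ * svSign (weight (flipInput v (flipInput b x))) *
        (inner ℂ (S.siteVec v (x v + 1)) (S.restOp v (flipInput b x) S.state)).re := by
  simp only [chshTerm, S.correlator_eq_inner v, restOp_flipInput_self]
  simp [flipInput, hb.symm]

/-- Both flips permute the inputs, so each of the four sums over the orbit members is the full
expression. -/
theorem four_mul_svetlichny (σ : ℝ) (b : Fin N) :
    4 * (σ * S.svetlichny) = ∑ x, S.chshTerm v σ b x := by
  set F : (Fin N → Fin 2) → ℝ := fun x => σ * svSign (weight x) * S.correlator x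
  have h : σ * S.svetlichny = ∑ x, F x := by
    rw [svetlichny, Finset.mul_sum]
    exact Finset.sum_congr rfl fun x _ => (mul_assoc _ _ _).symm
  have h1 : ∑ x, F (flipInput v (flipInput b x)) = ∑ x, F x := by
    rw [sum_flipInput b fun x => F (flipInput v x), sum_flipInput]
  simp only [chshTerm, Finset.sum_add_distrib]
  change _ = ∑ x, F x + ∑ x, F (flipInput v x) + ∑ x, F (flipInput b x) +
    ∑ x, F (flipInput v (flipInput b x))
  rw [h1, sum_flipInput, sum_flipInput, h]
  ring

theorem sign_sq {σ : ℝ} (hσ : σ ^ 2 = 1) (w : ℕ) : (σ * svSign w) ^ 2 = 1 := by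
  rw [mul_pow, hσ, svSign_sq, one_mul]

theorem sign_mul (σ : ℝ) {v b : Fin N} (hb : b ≠ v) (x : Fin N → Fin 2) :
    σ * svSign (weight x) * (σ * svSign (weight (flipInput v x))) =
      -(σ * svSign (weight (flipInput b x)) *
        (σ * svSign (weight (flipInput v (flipInput b x))))) := by
  have := svSign_flipInput hb x
  linear_combination σ ^ 2 * this

theorem chshTerm_le {σ : ℝ} (hσ : σ ^ 2 = 1) {b : Fin N} (hb : b ≠ v) (x : Fin N → Fin 2) :
    S.chshTerm v σ b x ≤ 2 * √2 := by
  rw [S.chshTerm_eq v σ hb]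
  exact chsh_le (sign_sq hσ _) (sign_sq hσ _) (sign_sq hσ _) (sign_sq hσ _) (sign_mul σ hb x)
    (S.norm_siteVec v _) (S.norm_siteVec v _) (S.norm_restOp_state v _) (S.norm_restOp_state v _)

theorem two_pow_mul_sqrt (hN : 2 ≤ N) :
    4 * (2 ^ (N - 1) * √2) = ∑ _x : Fin N → Fin 2, 2 * √2 := by
  obtain ⟨n, rfl⟩ := Nat.exists_eq_add_of_le hN
  simp only [Finset.sum_const, Finset.card_univ, Fintype.card_pi, Fintype.card_fin,
    Finset.prod_const, nsmul_eq_mul]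
  rw [show 2 + n - 1 = n + 1 by omega]
  push_cast
  ring

theorem svetlichny_le {σ : ℝ} (hσ : σ ^ 2 = 1) {b : Fin N} (hb : b ≠ v) (hN : 2 ≤ N) :
    σ * S.svetlichny ≤ 2 ^ (N - 1) * √2 := by
  refine le_of_mul_le_mul_left ?_ (by norm_num : (0 : ℝ) < 4)
  rw [S.four_mul_svetlichny v σ b, two_pow_mul_sqrt hN]
  exact Finset.sum_le_sum fun x _ => S.chshTerm_le v hσ hb x

theorem chshTerm_eq_of_max {σ : ℝ} (hσ : σ ^ 2 = 1) {b : Fin N} (hb : b ≠ v) (hN : 2 ≤ N)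
    (hmax : σ * S.svetlichny = 2 ^ (N - 1) * √2) (x : Fin N → Fin 2) :
    S.chshTerm v σ b x = 2 * √2 := by
  have h : ∑ x, S.chshTerm v σ b x = ∑ _x : Fin N → Fin 2, 2 * √2 := by
    rw [← S.four_mul_svetlichny v σ b, hmax, two_pow_mul_sqrt hN]
  exact (Finset.sum_eq_sum_iff_of_le fun x _ => S.chshTerm_le v hσ hb x).1 h x (Finset.mem_univ x)

/-- The block of the zero input alone suffices. Its weights are 0, 1, 1, 2, with signs `+`, `-`,
`-`, `-`. -/
theorem relations_of_max {σ : ℝ} (hσ : σ ^ 2 = 1) {b : Fin N} (hb : b ≠ v) (hN : 2 ≤ N)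
    (hmax : σ * S.svetlichny = 2 ^ (N - 1) * √2) :
    ‖S.restOp v 0 S.state‖ = 1 ∧ ‖S.restOp v (flipInput b 0) S.state‖ = 1 ∧
      (√2 : ℂ) • S.restOp v 0 S.state = (σ : ℂ) • (S.siteVec v 0 - S.siteVec v 1) ∧
      (√2 : ℂ) • S.restOp v (flipInput b 0) S.state =
        -((σ : ℂ) • (S.siteVec v 0 + S.siteVec v 1)) ∧
      ‖S.siteVec v 0‖ = 1 ∧ ‖S.siteVec v 1‖ = 1 := by
  have h := S.chshTerm_eq_of_max v hσ hb hN hmax 0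
  rw [S.chshTerm_eq v σ hb] at h
  obtain ⟨h1, h2, h3, h4, h5, h6⟩ := chsh_eq (sign_sq hσ _) (sign_sq hσ _) (sign_sq hσ _)
    (sign_sq hσ _) (sign_mul σ hb 0) (S.norm_siteVec v _) (S.norm_siteVec v _)
    (S.norm_restOp_state v _) (S.norm_restOp_state v _) h
  obtain ⟨m, w1, w2, w3, w4⟩ := exists_weight_flipInput hb 0
  have w0 : weight (0 : Fin N → Fin 2) = 0 := by simp [weight]
  have hm : m = 0 := by simpa [w0] using w1.symm
  subst hm
  have s0 : svSign 0 = 1 := by simp [svSign]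
  have s1 : svSign 1 = -1 := by simp [svSign]
  have s2 : svSign 2 = -1 := by rw [svSign_add_two 0, s0]
  simp only [Pi.zero_apply, zero_add, add_zero, Fin.val_zero, Fin.val_one, Nat.reduceAdd] at *
  rw [w0, w2, s0, s1] at h5
  rw [w3, w4, s1, s2] at h6
  refine ⟨h3, h4, h5.trans ?_, h6.trans ?_, h1, h2⟩ <;> push_cast <;> module

end Strategy

/-! ### Transfer of Pauli relations between subsystems. -/

section

section Relations

theorem apply_comm_of_commute {E : Type*} [NormedAddCommGroup E] [NormedSpace ℂ E]
    {f g : E →L[ℂ] E} (h : Commute f g) (v : E) : f (g v) = g (f v) := by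
  rw [← mul_apply_eq_comp, h.eq, mul_apply_eq_comp]

/-- As for a Bell pair, `x` acts on `ψ` like `T a` and `y` like `-T c`, with operators `a`, `c` of
another system. Passing to that system reverses the order of a product; the minus sign and the
anticommutation of `a` and `c` compensate, so `x y` and `a c` agree on `ψ`. This is why all parties
share one vector `φ`. -/
theorem pair_relations {E : Type*} [NormedAddCommGroup E] [NormedSpace ℂ E]
    {x y T a c : E →L[ℂ] E} {ψ : E} (hxT : Commute x T) (hyT : Commute y T) (hxc : Commute x c)
    (hya : Commute y a) (h1 : x (T ψ) = a ψ) (h2 : y (T ψ) = -c ψ)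
    (hT : T (T ψ) = ψ) (hTa : Commute T a) (hTc : Commute T c) (hac : a (c ψ) = -c (a ψ)) :
    x ψ = (T * a) ψ ∧ y ψ = (-(T * c)) ψ ∧ x (y ψ) = a (c ψ) ∧ x (y ψ) = -y (x ψ) := by
  have hx : x ψ = T (a ψ) := by
    nth_rewrite 1 [← hT]
    rw [apply_comm_of_commute hxT, h1]
  have hy : y ψ = -T (c ψ) := by
    nth_rewrite 1 [← hT]
    rw [apply_comm_of_commute hyT, h2, map_neg]
  have hxy : x (y ψ) = a (c ψ) := by
    rw [hy, map_neg, apply_comm_of_commute hTc, apply_comm_of_commute hxc, h1, hac]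
  have hyx : y (x ψ) = -a (c ψ) := by
    rw [hx, apply_comm_of_commute hTa, apply_comm_of_commute hya, h2, map_neg]
  exact ⟨hx, hy, hxy, by rw [hxy, hyx, neg_neg]⟩

/-- The operators `P = |1⟩⟨1|` and `X` (the bit flip) of a qubit of a subsystem, which act on the
state `ψ` like a given projection, with result `φ`, and like a given observable `O`. -/
structure IsQubitPair {X α γ : Type u} (e : X ≃ γ × α) (ψ φ : HSpace X)
    (O P F : HSpace α →L[ℂ] HSpace α) : Prop where
  star_proj : star P = P
  proj_mul_self : P * P = P
  star_flip_mul_self : star F * F = 1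
  act_proj : act e P ψ = φ
  act_flip : act e F ψ = act e O ψ
  act_flip_act_proj : act e F (act e P ψ) = act e (1 - P) (act e F ψ)

theorem IsQubitPair.norm_flip_le {X α γ : Type u} {e : X ≃ γ × α} {ψ φ : HSpace X}
    {O P F : HSpace α →L[ℂ] HSpace α} (h : IsQubitPair e ψ φ O P F) : ‖F‖ ≤ 1 :=
  ContinuousLinearMap.opNorm_le_bound _ zero_le_one fun v => by
    rw [norm_apply_eq_of_star_mul_self h.star_flip_mul_self, one_mul]

theorem exists_qubitPair_of_relations {X α γ : Type u} (e : X ≃ γ × α) {ψ : HSpace X}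
    {A B : HSpace α →L[ℂ] HSpace α} (hA : star A = A) (hB : star B = B)
    (hAA : act e A (act e A ψ) = ψ) (hBB : act e B (act e B ψ) = ψ)
    {T a c : HSpace X →L[ℂ] HSpace X} (hT : ∀ Z, Commute T (act e Z))
    (ha : ∀ Z, Commute a (act e Z)) (hc : ∀ Z, Commute c (act e Z)) (hTa : Commute T a)
    (hTc : Commute T c) (h1 : act e A (T ψ) = a ψ) (h2 : act e B (T ψ) = -c ψ)
    (hTT : T (T ψ) = ψ) (hac : a (c ψ) = -c (a ψ)) :
    ∃ P F, IsQubitPair e ψ ((1 / 2 : ℂ) • (ψ + Complex.I • a (c ψ))) A P F := by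
  obtain ⟨r1, r2, r3, r4⟩ := pair_relations (hT A).symm (hT B).symm (hc A).symm (ha B).symm
    h1 h2 hTT hTa hTc hac
  obtain ⟨P, F, g1, g2, g3, g4, g5, g6⟩ := exists_swap e ψ hA hB hAA hBB r4
    (fun Z => (hT Z).mul_left (ha Z)) (fun Z => ((hT Z).mul_left (hc Z)).neg_left) r1 r2
  exact ⟨P, F, g1, g2, g3, by rw [g4, r3], g5, g6⟩

variable {ι : Type} [DecidableEq ι] {α : ι → Type u} {δ π : Type u}
  {A : ∀ i, HSpace (α i) →L[ℂ] HSpace (α i)} {B : HSpace δ →L[ℂ] HSpace δ}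
  {ψ : HSpace ((∀ j, α j) × δ × π)}

theorem norm_update_le_one (hA : ∀ i, ‖A i‖ ≤ 1) (i j : ι) : ‖Function.update A i 1 j‖ ≤ 1 := by
  by_cases h : j = i
  · subst h; rw [Function.update_self]; exact ContinuousLinearMap.norm_id_le
  · rw [Function.update_of_ne h]; exact hA j

theorem onSite_update_apply_apply (hA : ∀ i, onSite δ π i (A i) (onSite δ π i (A i) ψ) = ψ)
    (i j : ι) : onSite δ π j (Function.update A i 1 j)
      (onSite δ π j (Function.update A i 1 j) ψ) = ψ := by
  by_cases h : j = i
  · subst h; simp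
  · rw [Function.update_of_ne h, hA]

variable [Fintype ι]

/-- The honest factors are contractions, so if the product preserves the norm of `ψ`, then `B` alone
already does. -/
theorem onGroup_apply_apply_of_norm_eq (hB : star B = B) (hA1 : ∀ i, ‖A i‖ ≤ 1)
    (hB1 : ‖B‖ ≤ 1) (h : ‖tensorOp π A B ψ‖ = ‖ψ‖) :
    onGroup α π B (onGroup α π B ψ) = ψ := by
  refine apply_apply_eq_self_of_norm_eq (by rw [← map_star, hB]) ((norm_act_le _ _).trans hB1) ?_
  refine le_antisymm ?_ ?_
  · simpa using ContinuousLinearMap.le_of_opNorm_le _ ((norm_act_le groupEquiv _).trans hB1) ψ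
  · rw [← h, tensorOp, mul_apply_eq_comp]
    simpa using ContinuousLinearMap.le_of_opNorm_le _
      (norm_honestProd_le_one (δ := δ) (π := π) hA1) (onGroup α π B ψ)

theorem tensorOp_apply_apply (hA : ∀ i, onSite δ π i (A i) (onSite δ π i (A i) ψ) = ψ)
    (hB : onGroup α π B (onGroup α π B ψ) = ψ) : tensorOp π A B (tensorOp π A B ψ) = ψ := by
  rw [← mul_apply_eq_comp, ← tensorOp_mul]
  refine tensorOp_apply_eq_self (fun i => ?_) ?_
  · rw [Pi.mul_apply, map_mul, mul_apply_eq_comp, hA]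
  · rw [map_mul, mul_apply_eq_comp, hB]

end Relations

/-! ### Qubits of the honest parties and of the group at the maximum. -/

namespace Strategy

variable {N : ℕ} {H : Finset (Fin N)} (S : Strategy.{u} H) (v : H) {σ : ℝ}

/-- The observables of the honest party `v` after a rotation by `π/4`. -/
def rotObs (σ : ℝ) (t : Fin 2) : HSpace (S.honestLabel v) →L[ℂ] HSpace (S.honestLabel v) :=
  ((σ / √2 : ℝ) : ℂ) • (S.obs v 0 + (-1 : ℂ) ^ (t + 1 : ℕ) • S.obs v 1)

theorem star_rotObs (t : Fin 2) : star (S.rotObs v σ t) = S.rotObs v σ t := by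
  rw [rotObs, star_smul, star_add, star_smul, star_obs, star_obs]
  simp

/-- The projection of the state that a qubit of the party `v` extracts. -/
def oneVec (σ : ℝ) : HSpace ((∀ i, S.honestLabel i) × S.dishonestLabel × S.purifierLabel) :=
  (1 / 2 : ℂ) • (S.state + Complex.I •
    onSite S.dishonestLabel S.purifierLabel v (S.rotObs v σ 0)
      (onSite S.dishonestLabel S.purifierLabel v (S.rotObs v σ 1) S.state))

local notation "L" => onSite (α := Strategy.honestLabel S) S.dishonestLabel S.purifierLabel

/-- Every honest party can take the role of the distinguished party of the CHSH expressions. -/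
theorem obs_apply_apply (hσ : σ ^ 2 = 1) (hN : 2 ≤ N)
    (hmax : σ * S.svetlichny = 2 ^ (N - 1) * √2) (i : H) (t : Fin 2) :
    L i (S.obs i t) (L i (S.obs i t) S.state) = S.state := by
  have := Fin.nontrivial_iff_two_le.2 hN
  obtain ⟨b, hb⟩ := exists_ne (i : Fin N)
  obtain ⟨-, -, -, -, h0, h1⟩ := S.relations_of_max i hσ hb hN hmax
  refine apply_apply_eq_self_of_norm_eq (by rw [← map_star, star_obs])
    ((norm_act_le _ _).trans (S.norm_obs i t)) ?_
  rw [S.norm_state]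
  rcases (by decide : ∀ t : Fin 2, t = 0 ∨ t = 1) t with rfl | rfl
  · exact h0
  · exact h1

theorem groupObs_apply_apply {x : Fin N → Fin 2} (h : ‖S.restOp v x S.state‖ = 1) :
    onGroup S.honestLabel S.purifierLabel (S.groupObs fun j => x j)
      (onGroup S.honestLabel S.purifierLabel (S.groupObs fun j => x j) S.state) = S.state := by
  refine onGroup_apply_apply_of_norm_eq (S.star_groupObs _)
    (norm_update_le_one (fun i => S.norm_obs i _) v) (S.norm_groupObs _) (h.trans S.norm_state.symm)

theorem restOp_apply_apply (hσ : σ ^ 2 = 1) (hN : 2 ≤ N)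
    (hmax : σ * S.svetlichny = 2 ^ (N - 1) * √2) {x : Fin N → Fin 2}
    (h : ‖S.restOp v x S.state‖ = 1) :
    S.restOp v x (S.restOp v x S.state) = S.state :=
  tensorOp_apply_apply
    (onSite_update_apply_apply (fun i => S.obs_apply_apply hσ hN hmax i _) v)
    (S.groupObs_apply_apply v h)

theorem onSite_rotObs_apply (t : Fin 2) :
    L v (S.rotObs v σ t) S.state = ((σ / √2 : ℝ) : ℂ) •
      (S.siteVec v 0 + (-1 : ℂ) ^ (t + 1 : ℕ) • S.siteVec v 1) := by
  rw [rotObs, map_smul, map_add, map_smul]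
  rfl

theorem rotObs_zero_apply (hσ : σ ^ 2 = 1) (hN : 2 ≤ N)
    (hmax : σ * S.svetlichny = 2 ^ (N - 1) * √2) :
    L v (S.rotObs v σ 0) S.state = S.restOp v 0 S.state := by
  have := Fin.nontrivial_iff_two_le.2 hN
  obtain ⟨b, hb⟩ := exists_ne (v : Fin N)
  obtain ⟨-, -, h, -⟩ := S.relations_of_max v hσ hb hN hmax
  have h2 : (√2 : ℂ) ≠ 0 := by simp
  rw [onSite_rotObs_apply, ← smul_right_inj h2, h, smul_smul]
  push_cast
  rw [mul_div_cancel₀ _ h2]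
  simp [sub_eq_add_neg]

theorem rotObs_one_apply (hσ : σ ^ 2 = 1) (hN : 2 ≤ N)
    (hmax : σ * S.svetlichny = 2 ^ (N - 1) * √2) {b : Fin N} (hb : b ≠ v) :
    L v (S.rotObs v σ 1) S.state = -S.restOp v (flipInput b 0) S.state := by
  obtain ⟨-, -, -, h, -⟩ := S.relations_of_max v hσ hb hN hmax
  have h2 : (√2 : ℂ) ≠ 0 := by simp
  rw [onSite_rotObs_apply, ← smul_right_inj h2, smul_neg, h, smul_smul]
  push_cast
  rw [mul_div_cancel₀ _ h2]
  simp

/-- The difference and the sum of two involutions always anticommute; here the squares need to be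
one only on the state. -/
theorem rotObs_anticomm (hσ : σ ^ 2 = 1) (hN : 2 ≤ N)
    (hmax : σ * S.svetlichny = 2 ^ (N - 1) * √2) :
    L v (S.rotObs v σ 0) (L v (S.rotObs v σ 1) S.state) =
      -L v (S.rotObs v σ 1) (L v (S.rotObs v σ 0) S.state) := by
  have h0 := S.obs_apply_apply hσ hN hmax v 0
  have h1 := S.obs_apply_apply hσ hN hmax v 1
  simp only [rotObs, map_smul, map_add, smul_apply, add_apply, h0, h1]
  simp only [Fin.val_zero, Fin.val_one, zero_add, pow_one, Nat.reduceAdd, neg_one_sq]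
  module

/-- The honest party `v` after rotation, and the other parties as they are. -/
def pauliObs (σ : ℝ) (i : H) : HSpace (S.honestLabel i) →L[ℂ] HSpace (S.honestLabel i) :=
  Function.update (fun i : H => S.obs i 0) v (S.rotObs v σ 0) i

theorem exists_qubitPair_self (hσ : σ ^ 2 = 1) (hN : 2 ≤ N)
    (hmax : σ * S.svetlichny = 2 ^ (N - 1) * √2) :
    ∃ P F, IsQubitPair (siteEquiv v) S.state (S.oneVec v σ) (S.rotObs v σ 0) P F := by
  have := Fin.nontrivial_iff_two_le.2 hN
  obtain ⟨b, hb⟩ := exists_ne (v : Fin N)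
  obtain ⟨n0, nb, -⟩ := S.relations_of_max v hσ hb hN hmax
  have hX := S.rotObs_zero_apply v hσ hN hmax
  have hY := S.rotObs_one_apply v hσ hN hmax hb
  -- With `R` the operator of the other systems that agrees with the rotated observable on the
  -- state: `X X ψ = X R ψ = R X ψ = R R ψ = ψ`.
  have hXX : L v (S.rotObs v σ 0) (L v (S.rotObs v σ 0) S.state) = S.state := by
    rw [hX, ← apply_comm_of_commute (S.restOp_commute_onSite v _ _), hX,
      S.restOp_apply_apply v hσ hN hmax n0]
  have hYY : L v (S.rotObs v σ 1) (L v (S.rotObs v σ 1) S.state) = S.state := by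
    rw [hY, map_neg, ← apply_comm_of_commute (S.restOp_commute_onSite v _ _), hY, map_neg, neg_neg,
      S.restOp_apply_apply v hσ hN hmax nb]
  obtain ⟨P, F, h1, h2, h3, h4, h5, h6⟩ := exists_swap (siteEquiv v) S.state
    (S.star_rotObs v 0) (S.star_rotObs v 1) hXX hYY (S.rotObs_anticomm v hσ hN hmax)
    (QA := S.restOp v 0) (QB := -S.restOp v (flipInput b 0))
    (S.restOp_commute_onSite v _) (fun T => (S.restOp_commute_onSite v _ T).neg_left) hX hY
  exact ⟨P, F, h1, h2, h3, h4, h5, h6⟩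

/-- The operator of all systems other than those of the honest parties `v` and `i`, for zero
inputs. -/
def restOp₂ (i : H) :=
  tensorOp S.purifierLabel
    (Function.update (Function.update (fun j : H => S.obs j 0) v 1) i 1) (S.groupObs 0)

variable {v} in
theorem restOp_zero_eq_onSite_mul {i : H} (hi : i ≠ v) :
    S.restOp v 0 = L i (S.obs i 0) * S.restOp₂ v i := by
  rw [restOp, tensorOp_eq_onSite_mul _ _ i, Function.update_of_ne hi]
  rfl

variable {v} in
theorem restOp_flipInput_eq_onSite_mul {i : H} (hi : i ≠ v) :
    S.restOp v (flipInput i 0) = L i (S.obs i 1) * S.restOp₂ v i := by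
  have h1 : Function.update (Function.update (fun j : H => S.obs j (flipInput (i : Fin N) 0 j)) v 1)
      i 1 = Function.update (Function.update (fun j : H => S.obs j 0) v 1) i 1 := by
    ext1 j
    by_cases hj : j = i
    · subst hj; simp
    · by_cases hjv : j = v
      · subst hjv; simp [Function.update_of_ne hj]
      · simp only [Function.update_of_ne hj, Function.update_of_ne hjv, flipInput]
        rw [Function.update_of_ne fun h => hj (Subtype.ext h)]
        rfl
  have h2 : (fun j : Dishonest H => flipInput (i : Fin N) 0 j) = 0 := by
    ext1 j
    rw [flipInput, Function.update_of_ne]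
    · rfl
    · rintro h; exact j.2 (h ▸ i.2)
  have h3 : flipInput (i : Fin N) 0 i = 1 := by simp [flipInput]
  rw [restOp, tensorOp_eq_onSite_mul _ _ i, Function.update_of_ne hi, h1, h2, h3]
  rfl

/-- Take `b = i`: the operators of the rest at the two inputs then differ only in the observable of
`i`, and their common factor `restOp₂` serves as `T` in `pair_relations`. -/
theorem exists_qubitPair_of_ne (hσ : σ ^ 2 = 1) (hN : 2 ≤ N)
    (hmax : σ * S.svetlichny = 2 ^ (N - 1) * √2) {i : H} (hi : i ≠ v) :
    ∃ P F, IsQubitPair (siteEquiv i) S.state (S.oneVec v σ) (S.obs i 0) P F := by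
  have hiv : (i : Fin N) ≠ v := fun h => hi (Subtype.ext h)
  obtain ⟨n0, -⟩ := S.relations_of_max v hσ hiv hN hmax
  have hsq := onSite_update_apply_apply (onSite_update_apply_apply (A := fun j : H => S.obs j 0)
    (fun j => S.obs_apply_apply hσ hN hmax j 0) v) i
  have hgr : onGroup S.honestLabel S.purifierLabel (S.groupObs 0)
      (onGroup S.honestLabel S.purifierLabel (S.groupObs 0) S.state) = S.state :=
    S.groupObs_apply_apply (x := 0) v n0
  have hTT : S.restOp₂ v i (S.restOp₂ v i S.state) = S.state :=
    tensorOp_apply_apply hsq hgr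
  have hTi : ∀ Z, Commute (S.restOp₂ v i) (L i Z) := tensorOp_commute_onSite _ _ i (by simp)
  have hTv : ∀ Z, Commute (S.restOp₂ v i) (L v Z) :=
    tensorOp_commute_onSite _ _ v (by rw [Function.update_of_ne hi.symm, Function.update_self])
  have hc : ∀ W Z, Commute (L v W) (L i Z) := fun W Z => onSite_commute hi.symm W Z
  have h1 : L i (S.obs i 0) (S.restOp₂ v i S.state) = L v (S.rotObs v σ 0) S.state := by
    rw [S.rotObs_zero_apply v hσ hN hmax, S.restOp_zero_eq_onSite_mul hi, mul_apply_eq_comp]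
  have h2 : L i (S.obs i 1) (S.restOp₂ v i S.state) = -L v (S.rotObs v σ 1) S.state := by
    rw [S.rotObs_one_apply v hσ hN hmax hiv, S.restOp_flipInput_eq_onSite_mul hi,
      mul_apply_eq_comp, neg_neg]
  exact exists_qubitPair_of_relations (siteEquiv i)
    (S.star_obs i 0) (S.star_obs i 1) (S.obs_apply_apply hσ hN hmax i 0)
    (S.obs_apply_apply hσ hN hmax i 1) hTi (hc _)
    (hc _) (hTv _) (hTv _) h1 h2 hTT (S.rotObs_anticomm v hσ hN hmax)

theorem restOp_flipInput_eq_mul_onGroup (c : Dishonest H) :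
    S.restOp v (flipInput c 0) =
      honestProd S.dishonestLabel S.purifierLabel
        (Function.update (fun j : H => S.obs j 0) v 1) *
      onGroup S.honestLabel S.purifierLabel (S.groupObs fun j => flipInput (c : Fin N) 0 j) := by
  have : (fun j : H => S.obs j (flipInput (c : Fin N) 0 j)) = fun j : H => S.obs j 0 := by
    ext1 j
    rw [flipInput, Function.update_of_ne]
    · rfl
    · rintro h; exact c.2 (h ▸ j.2)
  rw [restOp, this]
  rfl

/-- Flipping the input of one member `c` changes the joint observable only, so the group behaves as
a single party with the two observables of inputs zero and `flipInput c 0`. -/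
theorem exists_qubitPair_group (hσ : σ ^ 2 = 1) (hN : 2 ≤ N)
    (hmax : σ * S.svetlichny = 2 ^ (N - 1) * √2) (c : Dishonest H) :
    ∃ P F, IsQubitPair groupEquiv S.state (S.oneVec v σ) (S.groupObs 0) P F := by
  have hcv : (c : Fin N) ≠ v := fun h => c.2 (h ▸ v.2)
  obtain ⟨n0, nb, -⟩ := S.relations_of_max v hσ hcv hN hmax
  have hTD : ∀ Z, Commute (honestProd S.dishonestLabel S.purifierLabel
      (Function.update (fun j : H => S.obs j 0) v 1))
      (onGroup S.honestLabel S.purifierLabel Z) := honestProd_commute_onGroup _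
  have hTv : ∀ Z, Commute (honestProd S.dishonestLabel S.purifierLabel
      (Function.update (fun j : H => S.obs j 0) v 1)) (L v Z) :=
    honestProd_commute_onSite _ v (by simp)
  have hsq := onSite_update_apply_apply (A := fun j : H => S.obs j 0)
    (fun j => S.obs_apply_apply hσ hN hmax j 0) v
  have hgr : onGroup S.honestLabel S.purifierLabel 1
      (onGroup S.honestLabel S.purifierLabel 1 S.state) = S.state := by simp
  have hTT := tensorOp_apply_apply hsq hgr
  rw [tensorOp_one] at hTT
  have hc : ∀ W Z, Commute (L v W) (onGroup S.honestLabel S.purifierLabel Z) :=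
    fun W Z => onSite_commute_onGroup v W Z
  refine exists_qubitPair_of_relations groupEquiv
    (S.star_groupObs 0) (S.star_groupObs fun j => flipInput (c : Fin N) 0 j)
    (S.groupObs_apply_apply (x := 0) v n0) (S.groupObs_apply_apply (x := flipInput (c : Fin N) 0) v nb) hTD
    (hc _) (hc _) (hTv _) (hTv _)
    ?_ ?_ hTT (S.rotObs_anticomm v hσ hN hmax)
  · rw [S.rotObs_zero_apply v hσ hN hmax, ← apply_comm_of_commute (hTD _)]
    rfl
  · rw [S.rotObs_one_apply v hσ hN hmax hcv, S.restOp_flipInput_eq_mul_onGroup,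
      mul_apply_eq_comp, neg_neg, ← apply_comm_of_commute (hTD _)]

/-- This is the stabilizer `X ⊗ ⋯ ⊗ X` of the GHZ state: on `ψ` the rotated observable of `v` agrees
with the product of the others, which squares to one there. -/
theorem tensorOp_pauliObs_apply (hσ : σ ^ 2 = 1) (hN : 2 ≤ N)
    (hmax : σ * S.svetlichny = 2 ^ (N - 1) * √2) :
    tensorOp S.purifierLabel (S.pauliObs v σ) (S.groupObs 0) S.state = S.state := by
  have := Fin.nontrivial_iff_two_le.2 hN
  obtain ⟨b, hb⟩ := exists_ne (v : Fin N)
  obtain ⟨n0, -⟩ := S.relations_of_max v hσ hb hN hmax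
  have h : tensorOp S.purifierLabel (S.pauliObs v σ) (S.groupObs 0) =
      L v (S.rotObs v σ 0) * S.restOp v 0 := by
    have hu : Function.update (S.pauliObs v σ) v 1 =
        Function.update (fun i : H => S.obs i 0) v 1 := by
      ext1 j
      by_cases hj : j = v
      · subst hj; simp
      · simp [Function.update_of_ne hj, pauliObs]
    rw [tensorOp_eq_onSite_mul _ _ v, hu, pauliObs, Function.update_self]
    rfl
  rw [h, mul_apply_eq_comp, ← apply_comm_of_commute (S.restOp_commute_onSite v _ _),
    S.rotObs_zero_apply v hσ hN hmax, S.restOp_apply_apply v hσ hN hmax n0]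

theorem exists_qubitPairs (hσ : σ ^ 2 = 1) (hN : 2 ≤ N)
    (hmax : σ * S.svetlichny = 2 ^ (N - 1) * √2) :
    ∃ P F : ∀ i : H, HSpace (S.honestLabel i) →L[ℂ] HSpace (S.honestLabel i),
      ∀ i, IsQubitPair (siteEquiv i) S.state (S.oneVec v σ) (S.pauliObs v σ i) (P i) (F i) := by
  have h : ∀ i, ∃ P F, IsQubitPair (siteEquiv i) S.state (S.oneVec v σ) (S.pauliObs v σ i) P F := by
    intro i
    by_cases hi : i = v
    · subst hi
      rw [pauliObs, Function.update_self]
      exact S.exists_qubitPair_self i hσ hN hmax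
    · rw [pauliObs, Function.update_of_ne hi]
      exact S.exists_qubitPair_of_ne v hσ hN hmax hi
  choose P F h using h
  exact ⟨P, F, h⟩

end Strategy

end

/-! ### Isometries given by their components. -/

section Isometry

variable {J : Type} [Fintype J] {α κ : Type u}

/-- The separation of a label of finite range from another one. -/
def finiteSplit (J : Type) (κ : Type u) : J × κ ≃ ULift.{u} J × κ :=
  Equiv.ulift.symm.prodCongr (Equiv.refl κ)

/-- The isometry `v ↦ ∑ⱼ |j⟩ ⊗ Tⱼ v`. -/
def sumIsometry (T : J → HSpace α →L[ℂ] HSpace κ) (hT : ∀ v, ∑ j, ‖T j v‖ ^ 2 = ‖v‖ ^ 2) :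
    HSpace α →ₗᵢ[ℂ] HSpace (J × κ) where
  toFun v := ofSlices (finiteSplit J κ) (fun j => T j.down v) (hasSum_fintype _).summable
  map_add' v w := slice_ext (finiteSplit J κ) fun j => by simp [slice_add]
  map_smul' c v := slice_ext (finiteSplit J κ) fun j => by simp [slice_smul]
  norm_map' v := by
    refine (pow_left_inj₀ (norm_nonneg _) (norm_nonneg _) two_ne_zero).1 ?_
    have h := hasSum_slice_norm_sq (finiteSplit J κ)
      (ofSlices (finiteSplit J κ) (fun j => T j.down v) (hasSum_fintype _).summable)
    simp only [slice_ofSlices] at h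
    refine h.unique ?_
    rw [← hT v, ← Equiv.ulift.{u}.sum_comp]
    exact hasSum_fintype _

theorem sumIsometry_apply (T : J → HSpace α →L[ℂ] HSpace κ)
    (hT : ∀ v, ∑ j, ‖T j v‖ ^ 2 = ‖v‖ ^ 2) (v : HSpace α) (j : J) (k : κ) :
    sumIsometry T hT v (j, k) = T j v k := rfl

theorem tensorApply_sumIsometry {ι : Type} [Fintype ι] [DecidableEq ι] {α : ι → Type u}
    {δ π : Type u} {J' : ι → Type} [∀ i, Fintype (J' i)]
    (T : ∀ i, J' i → HSpace (α i) →L[ℂ] HSpace (α i))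
    (hT : ∀ i v, ∑ j, ‖T i j v‖ ^ 2 = ‖v‖ ^ 2) (T' : J → HSpace δ →L[ℂ] HSpace δ)
    (hT' : ∀ v, ∑ j, ‖T' j v‖ ^ 2 = ‖v‖ ^ 2)
    (ψ : HSpace ((∀ i, α i) × δ × π)) (τ : ∀ i, J' i) (t : J) (k : ∀ i, α i) (d : δ) (p : π) :
    tensorApply (fun i => (sumIsometry (T i) (hT i)).toContinuousLinearMap)
      (sumIsometry T' hT').toContinuousLinearMap ψ (fun i => (τ i, k i), (t, d), p) =
      tensorOp π (fun i => T i (τ i)) (T' t) ψ (k, d, p) := by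
  rw [← tensorApply_eq]
  rfl

end Isometry

/-! ### The action of the swap isometries on the state. -/

section Qubits

variable {ι : Type} [Fintype ι] [DecidableEq ι] {α : ι → Type u} {δ π : Type u}
  {ψ φ : HSpace ((∀ j, α j) × δ × π)} {O P F : ∀ i, HSpace (α i) →L[ℂ] HSpace (α i)}
  {B G : HSpace δ →L[ℂ] HSpace δ}

theorem tensorOp_apply_congr (h : ∀ i, onSite δ π i (F i) ψ = onSite δ π i (O i) ψ)
    (hB : onGroup α π B ψ = onGroup α π G ψ) : tensorOp π F B ψ = tensorOp π O G ψ := by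
  rw [tensorOp, (honestProd_commute_onGroup F B).eq, mul_apply_eq_comp, honestProd_apply_congr h,
    ← apply_comm_of_commute (honestProd_commute_onGroup O B), hB, tensorOp, mul_apply_eq_comp]

/-- Write `φ` as the projection of `ψ` at the single party `v`. Only the flip of `v` meets that
projection and turns it into its complement; the rest commutes past. -/
theorem tensorOp_flip_apply {v : ι} (hv : IsQubitPair (siteEquiv v) ψ φ (O v) (P v) (F v))
    (h : tensorOp π F B ψ = ψ) : tensorOp π F B φ = ψ - φ := by
  have hc : ∀ Z, Commute (tensorOp π (Function.update F v 1) B) (onSite δ π v Z) :=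
    tensorOp_commute_onSite _ B v (by simp)
  rw [tensorOp_eq_onSite_mul F B v, ← (hc _).eq, mul_apply_eq_comp] at h ⊢
  rw [← hv.act_proj, hv.act_flip_act_proj, apply_comm_of_commute (hc _), h, map_sub, map_one,
    sub_apply, one_apply_eq_self]

theorem IsQubitPair.norm_sq_add {X α γ : Type u} {e : X ≃ γ × α} {ψ φ : HSpace X}
    {O P F : HSpace α →L[ℂ] HSpace α} (h : IsQubitPair e ψ φ O P F) :
    ‖ψ - φ‖ ^ 2 + ‖φ‖ ^ 2 = ‖ψ‖ ^ 2 := by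
  have := norm_swap_sq (P := act e P) (X := 1) (by rw [← map_star, h.star_proj])
    (by rw [← map_mul, h.proj_mul_self]) (by simp) ψ
  simpa [h.act_proj] using this

theorem norm_eq_of_flip {E : Type*} [NormedAddCommGroup E] [NormedSpace ℂ E] {V : E →L[ℂ] E}
    {ψ φ : E} (hV : ‖V‖ ≤ 1) (h : V ψ = ψ) (h' : V φ = ψ - φ) : ‖ψ - φ‖ = ‖φ‖ := by
  refine le_antisymm ?_ ?_
  · simpa [h'] using V.le_of_opNorm_le hV φ
  · have : V (ψ - φ) = φ := by rw [map_sub, h, h', sub_sub_cancel]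
    simpa [this] using V.le_of_opNorm_le hV (ψ - φ)

/-- A contraction exchanges `φ` and `ψ - φ`, so their norms agree; they are orthogonal with sum `ψ`,
hence both have norm `1/√2`. -/
theorem norm_sqrt_two_smul_sub {v : ι} (hP : ∀ i, IsQubitPair (siteEquiv i) ψ φ (O i) (P i) (F i))
    (hB : ‖B‖ ≤ 1) (h : tensorOp π F B ψ = ψ) (hψ : ‖ψ‖ = 1) : ‖(√2 : ℂ) • (ψ - φ)‖ = 1 := by
  have h1 := norm_eq_of_flip (norm_tensorOp_le_one (fun i => (hP i).norm_flip_le) hB) h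
    (tensorOp_flip_apply (hP v) h)
  have h2 := (hP v).norm_sq_add
  rw [← h1, hψ] at h2
  rw [← pow_left_inj₀ (norm_nonneg _) zero_le_one two_ne_zero, norm_smul, mul_pow,
    Complex.norm_real, Real.norm_eq_abs, sq_abs, Real.sq_sqrt (by norm_num)]
  linarith

theorem honestProd_swapOp_apply_of_flip [Nonempty ι]
    (hP : ∀ i, IsQubitPair (siteEquiv i) ψ φ (O i) (P i) (F i)) (τ : ι → Fin 2) :
    honestProd δ π (fun i => swapOp (P i) (F i) (τ i)) ψ =
      if ∀ i, τ i = 0 then ψ - φ else if ∀ i, τ i = 1 then honestProd δ π F φ else 0 :=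
  honestProd_swapOp_apply (fun i => (hP i).proj_mul_self) (fun i => (hP i).act_proj) τ

theorem tensorOp_swapOp_apply [Nonempty ι] {O' P' F' : HSpace δ →L[ℂ] HSpace δ}
    (hP : ∀ i, IsQubitPair (siteEquiv i) ψ φ (O i) (P i) (F i))
    (hP' : IsQubitPair groupEquiv ψ φ O' P' F') (h : tensorOp π F F' ψ = ψ)
    (τ : ι → Fin 2) (t : Fin 2) :
    tensorOp π (fun i => swapOp (P i) (F i) (τ i)) (swapOp P' F' t) ψ =
      if (∀ i, τ i = 0) ∧ t = 0 then ψ - φ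
      else if (∀ i, τ i = 1) ∧ t = 1 then ψ - φ else 0 := by
  obtain ⟨v⟩ := id ‹Nonempty ι›
  have hflip := tensorOp_flip_apply (hP v) h
  have hφ : ψ - φ = onGroup α π (1 - P') ψ := by
    rw [map_sub, map_one, sub_apply, hP'.act_proj, one_apply_eq_self]
  have hc := fun A B => honestProd_commute_onGroup (α := α) (π := π) (δ := δ) A B
  rw [tensorOp, (hc _ _).eq, mul_apply_eq_comp, honestProd_swapOp_apply_of_flip hP]
  have h00 : (1 - P') * (1 - P') = 1 - P' := by
    rw [mul_sub, sub_mul, sub_mul, hP'.proj_mul_self]; simp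
  have h10 : P' * (1 - P') = 0 := by rw [mul_sub, hP'.proj_mul_self]; simp
  have h01 : (1 - P') * P' = 0 := by rw [sub_mul, hP'.proj_mul_self]; simp
  obtain rfl | rfl := (by decide : ∀ t : Fin 2, t = 0 ∨ t = 1) t
  · simp only [swapOp, if_true, and_true, zero_ne_one, and_false, if_false]
    split_ifs with h0 h1
    · rw [hφ, ← mul_apply_eq_comp, ← map_mul, h00]
    · rw [← apply_comm_of_commute (hc _ _), ← hP'.act_proj, ← mul_apply_eq_comp (act _ _),
        ← map_mul, h01]
      simp
    · simp
  · simp only [swapOp, one_ne_zero, if_false, and_true, and_false]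
    split_ifs with h0 h1 h1
    · obtain ⟨i⟩ := id ‹Nonempty ι›
      exact absurd ((h0 i).symm.trans (h1 i)) zero_ne_one
    · rw [hφ, ← mul_apply_eq_comp, ← map_mul, mul_assoc, h10]
      simp
    -- On the all-ones string, `P'` fixes `φ`, and the flips of all systems together turn `φ` into
    -- `ψ - φ`.
    · rw [← hflip, tensorOp, (hc _ _).eq, mul_apply_eq_comp, map_mul, mul_apply_eq_comp]
      congr 1
      rw [← apply_comm_of_commute (hc _ _), ← hP'.act_proj, ← mul_apply_eq_comp (act _ _),
        ← map_mul, hP'.proj_mul_self]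
    · simp

theorem sum_norm_swapOp_sq {α : Type u} {P F : HSpace α →L[ℂ] HSpace α} (hP : star P = P)
    (hPP : P * P = P) (hF : star F * F = 1) (v : HSpace α) :
    ∑ t, ‖swapOp P F t v‖ ^ 2 = ‖v‖ ^ 2 := by
  rw [Fin.sum_univ_two]
  exact norm_swap_sq hP hPP hF v

theorem IsQubitPair.sum_norm_swapOp_sq {X α γ : Type u} {e : X ≃ γ × α} {ψ φ : HSpace X}
    {O P F : HSpace α →L[ℂ] HSpace α} (h : IsQubitPair e ψ φ O P F) (v : HSpace α) :
    ∑ t, ‖swapOp P F t v‖ ^ 2 = ‖v‖ ^ 2 :=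
  DishonestSelfTest.sum_norm_swapOp_sq h.star_proj h.proj_mul_self h.star_flip_mul_self v

end Qubits

/-! ### Repeating the qubit of the group by CNOT gates. -/

section Repetition

variable {J : Type} [Fintype J] [DecidableEq J] {α : Type u}

/-- The components of the isometry into qubits labelled by `J` obtained by repeating a qubit. -/
def repeatOp (T : Fin 2 → HSpace α →L[ℂ] HSpace α) (t : J → Fin 2) : HSpace α →L[ℂ] HSpace α :=
  if t = 0 then T 0 else if t = 1 then T 1 else 0

/-- Nonemptiness of `J` keeps the two constant strings distinct, so both components are counted. -/
theorem sum_norm_repeatOp_sq [Nonempty J] (T : Fin 2 → HSpace α →L[ℂ] HSpace α) (v : HSpace α) :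
    ∑ t : J → Fin 2, ‖repeatOp T t v‖ ^ 2 = ∑ t, ‖T t v‖ ^ 2 := by
  have : ∀ t : J → Fin 2, ‖repeatOp T t v‖ ^ 2 =
      (if t = 0 then ‖T 0 v‖ ^ 2 else 0) + if t = 1 then ‖T 1 v‖ ^ 2 else 0 := by
    intro t
    rw [repeatOp]
    split_ifs with h0 h1
    · exact absurd (congrFun (h0.symm.trans h1) (Classical.arbitrary J)) (by simp)
    all_goals simp
  simp [this, Finset.sum_add_distrib]

/-- Undoing the CNOT gates leaves all appended qubits at `0` exactly when every label equals that of
`c`, that is, on the constant strings. -/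
theorem sumIsometry_repeatOp (T : Fin 2 → HSpace α →L[ℂ] HSpace α) (hT)
    (hT' : ∀ v, ∑ t : J → Fin 2, ‖repeatOp T t v‖ ^ 2 = ‖v‖ ^ 2) (c : J) (v : HSpace α) :
    (sumIsometry (repeatOp T) hT' v : (J → Fin 2) × α → ℂ) =
      cnot c (appendZeros c (sumIsometry T hT v)) := by
  ext ⟨t, d⟩
  have two : ∀ t : Fin 2, t = 0 ∨ t = 1 := by decide
  rw [sumIsometry_apply, repeatOp]
  simp only [cnot, appendZeros, sumIsometry_apply]
  have hc : cnotLabel c t c = t c := by simp [cnotLabel]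
  have hiff : (∀ j, j ≠ c → cnotLabel c t j = 0) ↔ ∀ j, t j = t c := by
    have : ∀ a b : Fin 2, a + b = 0 ↔ a = b := by decide
    refine forall_congr' fun j => ?_
    by_cases hj : j = c
    · simp [hj]
    · simp [hj, cnotLabel, this]
  rw [hc]
  simp only [hiff]
  split_ifs with h0 h1 h1 h2 h2
  · subst h0; rfl
  · subst h0; exact absurd (fun _ => rfl) h1
  · subst h1; rfl
  · subst h1; exact absurd (fun _ => rfl) h2
  · rcases two (t c) with h | h <;> rw [h] at h2
    · exact absurd (funext h2) h0
    · exact absurd (funext h2) h1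
  · rfl

end Repetition

/-- The factor `√2` that normalizes `ψ - φ` cancels the one in the GHZ state. -/
theorem ghz_mul {ι : Type} [Fintype ι] [Nonempty ι] (τ : ι → Fin 2) (c : ℂ) :
    ghz τ * ((√2 : ℂ) * c) =
      if ∀ i, τ i = 0 then c else if ∀ i, τ i = 1 then c else 0 := by
  have h2 : ((√2 : ℝ) : ℂ) ≠ 0 := by simp
  obtain ⟨i⟩ := id ‹Nonempty ι›
  rw [ghz, div_mul_eq_mul_div, div_eq_iff h2]
  by_cases h0 : ∀ i, τ i = 0
  · have h1 : ¬ ∀ i, τ i = 1 := fun h1 => by simpa [h0 i] using h1 i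
    rw [if_pos h0, if_neg h1, if_pos h0]
    ring
  · simp only [h0, if_false]
    split_ifs <;> ring

/-! ### Certification of the GHZ state. -/

namespace Strategy

variable {N : ℕ} {H : Finset (Fin N)} (S : Strategy.{u} H)

theorem groupObs_of_isEmpty [IsEmpty (Dishonest H)] (x : Dishonest H → Fin 2) :
    S.groupObs x = 1 := by
  rw [groupObs, signedSum, ← S.dishonestPOVM_sum x]
  simp

theorem forall_fin_iff (τ : Fin N → Fin 2) (t : Fin 2) :
    (∀ i, τ i = t) ↔ (∀ i : H, τ i = t) ∧ ∀ j : Dishonest H, τ j = t := by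
  refine ⟨fun h => ⟨fun i => h i, fun j => h j⟩, fun h i => ?_⟩
  by_cases hi : i ∈ H
  · exact h.1 ⟨i, hi⟩
  · exact h.2 ⟨i, hi⟩

theorem certifiesGHZ_of_isEmpty [IsEmpty (Dishonest H)] (v : H)
    {φ : HSpace ((∀ i, S.honestLabel i) × S.dishonestLabel × S.purifierLabel)}
    {O P F : ∀ i : H, HSpace (S.honestLabel i) →L[ℂ] HSpace (S.honestLabel i)}
    (hP : ∀ i, IsQubitPair (siteEquiv i) S.state φ (O i) (P i) (F i))
    (h : tensorOp S.purifierLabel F (1 : HSpace S.dishonestLabel →L[ℂ] HSpace S.dishonestLabel)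
      S.state = S.state) : S.CertifiesGHZ := by
  have : Nonempty H := ⟨v⟩
  have : Nonempty (Fin N) := ⟨v⟩
  refine ⟨S.honestLabel, S.dishonestLabel,
    fun i => sumIsometry (swapOp (P i) (F i)) (hP i).sum_norm_swapOp_sq,
    -- There is only the empty string of dishonest qubits, so the group keeps its system as it is.
    sumIsometry (fun _ => 1) (fun v => by simp), (√2 : ℂ) • (S.state - φ),
    norm_sqrt_two_smul_sub (v := v) hP ContinuousLinearMap.norm_id_le h S.norm_state, ?_,
    fun c => isEmptyElim c⟩
  intro τ k d p
  rw [tensorApply_sumIsometry, tensorOp_one, honestProd_swapOp_apply_of_flip hP, ← tensorOp_one,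
    tensorOp_flip_apply (hP v) h, lp.coeFn_smul, Pi.smul_apply, smul_eq_mul, ghz_mul]
  simp only [forall_fin_iff (H := H) τ, IsEmpty.forall_iff, and_true]
  split_ifs <;> rfl

/-- The single-qubit isometry of the group does not depend on `c`: repetition is symmetric in the
members, so any of them can serve as control. -/
theorem certifiesGHZ_of_nonempty [Nonempty (Dishonest H)] (v : H)
    {φ : HSpace ((∀ i, S.honestLabel i) × S.dishonestLabel × S.purifierLabel)}
    {O P F : ∀ i : H, HSpace (S.honestLabel i) →L[ℂ] HSpace (S.honestLabel i)}
    {O' P' F' : HSpace S.dishonestLabel →L[ℂ] HSpace S.dishonestLabel}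
    (hP : ∀ i, IsQubitPair (siteEquiv i) S.state φ (O i) (P i) (F i))
    (hP' : IsQubitPair groupEquiv S.state φ O' P' F')
    (h : tensorOp S.purifierLabel F F' S.state = S.state) : S.CertifiesGHZ := by
  have : Nonempty H := ⟨v⟩
  have : Nonempty (Fin N) := ⟨v⟩
  have key := tensorOp_swapOp_apply hP hP' h
  refine ⟨S.honestLabel, S.dishonestLabel,
    fun i => sumIsometry (swapOp (P i) (F i)) (hP i).sum_norm_swapOp_sq,
    sumIsometry (repeatOp (swapOp P' F'))
      (fun v => (sum_norm_repeatOp_sq _ v).trans (hP'.sum_norm_swapOp_sq v)),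
    (√2 : ℂ) • (S.state - φ),
    norm_sqrt_two_smul_sub (v := v) hP hP'.norm_flip_le h S.norm_state, ?_, fun c =>
    ⟨sumIsometry (swapOp P' F') hP'.sum_norm_swapOp_sq, ?_, fun v => sumIsometry_repeatOp _ _ _ c v⟩⟩
  · intro τ k d p
    rw [tensorApply_sumIsometry, lp.coeFn_smul, Pi.smul_apply, smul_eq_mul, ghz_mul, repeatOp]
    simp only [forall_fin_iff (H := H) τ, funext_iff, Pi.zero_apply, Pi.one_apply]
    obtain ⟨j⟩ := id ‹Nonempty (Dishonest H)›
    by_cases h0 : ∀ j : Dishonest H, τ j = 0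
    · have h1 : ¬ ∀ j : Dishonest H, τ j = 1 := fun h1 =>
        zero_ne_one ((h0 j).symm.trans (h1 j))
      rw [if_pos h0, key]
      simp only [eq_true h0, eq_false h1, and_true, and_false, if_false, zero_ne_one]
      split_ifs <;> rfl
    · rw [if_neg h0]
      by_cases h1 : ∀ j : Dishonest H, τ j = 1
      · rw [if_pos h1, key]
        simp only [eq_false h0, eq_true h1, and_true, and_false, if_false, one_ne_zero]
        split_ifs <;> rfl
      · have hz : ∀ A : ∀ i : H, HSpace (S.honestLabel i) →L[ℂ] HSpace (S.honestLabel i),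
            tensorOp S.purifierLabel A (0 : HSpace S.dishonestLabel →L[ℂ] _) = 0 := fun A => by
          rw [tensorOp, map_zero, mul_zero]
        rw [if_neg h1, hz]
        simp only [h0, h1, and_false, if_false]
        rfl
  · intro τ k d p
    rw [tensorApply_sumIsometry, lp.coeFn_smul, Pi.smul_apply, smul_eq_mul, ghz_mul, key]
    simp only [Option.forall, and_comm (a := τ none = _)]
    split_ifs <;> rfl

theorem certifiesGHZ_of_max (v : H) {σ : ℝ} (hσ : σ ^ 2 = 1) (hN : 2 ≤ N)
    (hmax : σ * S.svetlichny = 2 ^ (N - 1) * √2) : S.CertifiesGHZ := by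
  obtain ⟨P, F, hP⟩ := S.exists_qubitPairs v hσ hN hmax
  have hO := S.tensorOp_pauliObs_apply v hσ hN hmax
  rcases isEmpty_or_nonempty (Dishonest H) with he | ⟨⟨c⟩⟩
  · rw [groupObs_of_isEmpty] at hO
    exact S.certifiesGHZ_of_isEmpty v hP
      ((tensorOp_apply_congr (fun i => (hP i).act_flip) rfl).trans hO)
  · have : Nonempty (Dishonest H) := ⟨c⟩
    obtain ⟨P', F', hP'⟩ := S.exists_qubitPair_group v hσ hN hmax c
    exact S.certifiesGHZ_of_nonempty v hP hP'
      ((tensorOp_apply_congr (fun i => (hP i).act_flip) hP'.act_flip).trans hO)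

end Strategy

/-! ### An optimal strategy. -/

theorem inner_ket_left {α : Type u} (a : α) (f : HSpace α) : inner ℂ (ket a) f = f a := by
  classical
  rw [ket, lp.inner_single_left]
  simp

section PhaseFlip

/-- The observable `cos θ X + sin θ Y` of a qubit. -/
def phaseFlip (θ : ℝ) : HSpace (ULift.{u} (Fin 2)) →L[ℂ] HSpace (ULift.{u} (Fin 2)) :=
  Complex.exp (θ * Complex.I) • InnerProductSpace.rankOne ℂ (ket ⟨1⟩) (ket ⟨0⟩) +
    Complex.exp (-θ * Complex.I) • InnerProductSpace.rankOne ℂ (ket ⟨0⟩) (ket ⟨1⟩)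

theorem phaseFlip_apply_zero (θ : ℝ) (v : HSpace (ULift.{u} (Fin 2))) :
    phaseFlip θ v ⟨0⟩ = Complex.exp (-θ * Complex.I) * v ⟨1⟩ := by
  change Complex.exp (θ * Complex.I) * (inner ℂ (ket ⟨0⟩) v * ket (ULift.up 1) ⟨0⟩) +
    Complex.exp (-θ * Complex.I) * (inner ℂ (ket ⟨1⟩) v * ket (ULift.up 0) ⟨0⟩) = _
  simp [inner_ket_left, ket_apply]

theorem phaseFlip_apply_one (θ : ℝ) (v : HSpace (ULift.{u} (Fin 2))) :
    phaseFlip θ v ⟨1⟩ = Complex.exp (θ * Complex.I) * v ⟨0⟩ := by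
  change Complex.exp (θ * Complex.I) * (inner ℂ (ket ⟨0⟩) v * ket (ULift.up 1) ⟨1⟩) +
    Complex.exp (-θ * Complex.I) * (inner ℂ (ket ⟨1⟩) v * ket (ULift.up 0) ⟨1⟩) = _
  simp [inner_ket_left, ket_apply]

theorem exp_mul_exp_neg (z : ℂ) : Complex.exp z * Complex.exp (-z) = 1 := by
  rw [← Complex.exp_add]; simp

theorem phaseFlip_mul_self (θ : ℝ) : phaseFlip.{u} θ * phaseFlip θ = 1 := by
  have h := exp_mul_exp_neg (θ * Complex.I)
  ext v ⟨t⟩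
  rw [mul_apply_eq_comp, one_apply_eq_self]
  obtain rfl | rfl := (by decide : ∀ t : Fin 2, t = 0 ∨ t = 1) t
  · rw [phaseFlip_apply_zero, phaseFlip_apply_one, ← mul_assoc, neg_mul, mul_comm (Complex.exp _), h,
      one_mul]
  · rw [phaseFlip_apply_one, phaseFlip_apply_zero, ← mul_assoc, neg_mul, h, one_mul]

theorem star_phaseFlip (θ : ℝ) : star (phaseFlip.{u} θ) = phaseFlip θ := by
  have h : ∀ z : ℝ, star (Complex.exp (z * Complex.I)) = Complex.exp (-z * Complex.I) := fun z => by
    rw [Complex.star_def, ← Complex.exp_conj]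
    simp
  have h' : star (Complex.exp (-θ * Complex.I)) = Complex.exp (θ * Complex.I) := by
    rw [← h, star_star]
  rw [phaseFlip, star_add, star_smul, star_smul, h, h', ContinuousLinearMap.star_eq_adjoint,
    ContinuousLinearMap.star_eq_adjoint, InnerProductSpace.adjoint_rankOne,
    InnerProductSpace.adjoint_rankOne, add_comm]

theorem entry_phaseFlip_self (θ : ℝ) (t : Fin 2) :
    entry (phaseFlip.{u} θ) ⟨t⟩ ⟨t⟩ = 0 := by
  rw [entry_eq]
  obtain rfl | rfl := (by decide : ∀ t : Fin 2, t = 0 ∨ t = 1) t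
  · simp [phaseFlip_apply_zero, ket_apply]
  · simp [phaseFlip_apply_one, ket_apply]

theorem entry_phaseFlip_one_zero (θ : ℝ) :
    entry (phaseFlip.{u} θ) ⟨1⟩ ⟨0⟩ = Complex.exp (θ * Complex.I) := by
  simp [entry_eq, phaseFlip_apply_one, ket_apply]

theorem entry_phaseFlip_zero_one (θ : ℝ) :
    entry (phaseFlip.{u} θ) ⟨0⟩ ⟨1⟩ = Complex.exp (-θ * Complex.I) := by
  simp [entry_eq, phaseFlip_apply_zero, ket_apply]

/-- The operator is self-adjoint and satisfies `T * T = 2 T`, so it is half of `star T * T`. -/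
theorem isPositive_one_add_phaseFlip (θ : ℝ) (n : ℕ) :
    (1 + (-1 : ℂ) ^ n • phaseFlip.{u} θ).IsPositive := by
  set T := 1 + (-1 : ℂ) ^ n • phaseFlip.{u} θ with hT
  have hn : ((-1 : ℂ) ^ n) * (-1) ^ n = 1 := by rw [← mul_pow]; simp
  have hs : star T = T := by
    rw [hT, star_add, star_one, star_smul, star_phaseFlip]; simp
  have hTT : T * T = (2 : ℂ) • T := by
    rw [hT, mul_add, add_mul, add_mul, smul_mul_smul_comm, phaseFlip_mul_self, hn, mul_one, one_mul,
      mul_one]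
    module
  have h : T = (1 / 2 : ℂ) • (star T * T) := by
    rw [hs, hTT, smul_smul]; norm_num
  rw [h]
  refine ContinuousLinearMap.IsPositive.smul_of_nonneg ?_ ?_
  · exact ContinuousLinearMap.isPositive_adjoint_comp_self T
  · norm_num [Complex.le_def]

end PhaseFlip

theorem signedSum_phaseFlip (θ : ℝ) :
    signedSum (fun a : Fin 2 => (a : ℕ))
      (fun a => (1 / 2 : ℂ) • (1 + (-1 : ℂ) ^ (a : ℕ) • phaseFlip.{u} θ)) = phaseFlip θ := by
  rw [signedSum, Fin.sum_univ_two]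
  simp only [Fin.val_zero, Fin.val_one, pow_zero, pow_one]
  module

theorem cos_add_mul_pi_div_two (w : ℕ) :
    Real.cos (Real.pi / 4 + w * (Real.pi / 2)) = svSign w * (√2 / 2) := by
  induction w using Nat.twoStepInduction with
  | zero => simp [svSign]
  | one =>
    have : Real.pi / 4 + (1 : ℕ) * (Real.pi / 2) = Real.pi - Real.pi / 4 := by push_cast; ring
    rw [this, Real.cos_pi_sub, Real.cos_pi_div_four]
    simp [svSign]
  | more n ih _ =>
    have : Real.pi / 4 + (n + 2 : ℕ) * (Real.pi / 2) =
        Real.pi / 4 + n * (Real.pi / 2) + Real.pi := by push_cast; ring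
    rw [this, Real.cos_add_pi, ih, svSign_add_two]
    ring

theorem norm_ket_add_ket {α : Type u} {a b : α} (h : a ≠ b) :
    ‖((1 / √2 : ℝ) : ℂ) • (ket a + ket b)‖ = 1 := by
  have h0 : ‖ket a + ket b‖ ^ 2 = 2 := by
    have h1 : inner ℂ (ket a + ket b) (ket a + ket b) = (2 : ℂ) := by
      rw [inner_add_left, inner_ket_left, inner_ket_left]
      simp [ket_apply, h, h.symm]
      norm_num
    rw [← inner_self_eq_norm_sq (𝕜 := ℂ), h1]
    simp
  rw [← pow_left_inj₀ (norm_nonneg _) zero_le_one two_ne_zero, norm_smul, mul_pow, h0,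
    Complex.norm_real, Real.norm_eq_abs, sq_abs, div_pow, Real.sq_sqrt (by norm_num)]
  norm_num

theorem inner_ket_add_ket {α : Type u} (a b : α) (T : HSpace α →L[ℂ] HSpace α) :
    inner ℂ (((1 / √2 : ℝ) : ℂ) • (ket a + ket b)) (T (((1 / √2 : ℝ) : ℂ) • (ket a + ket b))) =
      (entry T a a + entry T a b + entry T b a + entry T b b) / 2 := by
  have h : ((1 / √2 : ℝ) : ℂ) * ((1 / √2 : ℝ) : ℂ) = 1 / 2 := by
    rw [← Complex.ofReal_mul, div_mul_div_comm, Real.mul_self_sqrt (by norm_num)]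
    norm_num
  rw [map_smul, inner_smul_left, inner_smul_right, Complex.conj_ofReal, ← mul_assoc, h,
    inner_add_left, inner_ket_left, inner_ket_left, map_add]
  simp only [lp.coeFn_add, Pi.add_apply, entry_eq]
  ring

namespace Strategy

variable {N : ℕ} {H : Finset (Fin N)}

/-- The angle of the observable of an honest party; that of `v` is rotated by `π/4`. -/
def angle (v i : H) (x : Fin 2) : ℝ := (if i = v then Real.pi / 4 else 0) + (x : ℕ) * (Real.pi / 2)

/-- The label `|t…t⟩` of the honest parties and of a given system of the group. -/
def constLabel (H : Finset (Fin N)) {δ : Type u} (f : Fin 2 → δ) (t : Fin 2) :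
    (∀ _ : H, ULift.{u} (Fin 2)) × δ × PUnit.{u + 1} :=
  (fun _ => ⟨t⟩, f t, PUnit.unit)

theorem constLabel_ne (v : H) {δ : Type u} (f : Fin 2 → δ) :
    constLabel H f 0 ≠ constLabel H f 1 := fun h => by
  have := congrFun (congrArg Prod.fst h) v
  simp [constLabel] at this

/-- A strategy for a state of the form `(|0…0⟩|f 0⟩ + |1…1⟩|f 1⟩)/√2`, with measurements in the
equatorial plane by the honest parties. -/
def equatorial (v : H) {δ : Type u} (f : Fin 2 → δ)
    (Q : (Dishonest H → Fin 2) → (Dishonest H → Fin 2) → HSpace δ →L[ℂ] HSpace δ)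
    (hQ : ∀ x a, (Q x a).IsPositive) (hQ1 : ∀ x, ∑ a, Q x a = 1) : Strategy.{u} H where
  honestLabel _ := ULift (Fin 2)
  dishonestLabel := δ
  purifierLabel := PUnit
  state := ((1 / √2 : ℝ) : ℂ) • (ket (constLabel H f 0) + ket (constLabel H f 1))
  norm_state := norm_ket_add_ket (constLabel_ne v f)
  honestPOVM i x a := (1 / 2 : ℂ) • (1 + (-1 : ℂ) ^ (a : ℕ) • phaseFlip (angle v i x))
  honestPOVM_pos i x a := (isPositive_one_add_phaseFlip _ _).smul_of_nonneg
    (by norm_num [Complex.le_def])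
  honestPOVM_sum i x := by
    rw [Fin.sum_univ_two]
    simp only [Fin.val_zero, Fin.val_one, pow_zero, pow_one]
    module
  dishonestPOVM := Q
  dishonestPOVM_pos := hQ
  dishonestPOVM_sum := hQ1

variable (v : H) {δ : Type u} (f : Fin 2 → δ)
  (Q : (Dishonest H → Fin 2) → (Dishonest H → Fin 2) → HSpace δ →L[ℂ] HSpace δ)
  (hQ : ∀ x a, (Q x a).IsPositive) (hQ1 : ∀ x, ∑ a, Q x a = 1)

theorem sum_angle (x : Fin N → Fin 2) :
    ∑ i : H, angle v i (x i) + (∑ j : Dishonest H, (x j : ℕ) : ℕ) * (Real.pi / 2) =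
      Real.pi / 4 + weight x * (Real.pi / 2) := by
  simp only [angle, Finset.sum_add_distrib, Finset.sum_ite_eq', Finset.mem_univ, if_true,
    ← Finset.sum_mul]
  rw [weight, ← Fintype.sum_subtype_add_sum_subtype (· ∈ H) fun i => (x i : ℕ), add_assoc, ← add_mul]
  push_cast
  congr!

/-- The diagonal terms vanish because the observable of `v` has zero diagonal, whatever `D` is. In
the two cross terms the phases multiply to `exp (± i Θ)`, with `Θ` the sum of all angles. -/
theorem inner_tensorOp_phaseFlip (x : Fin N → Fin 2) (D : HSpace δ →L[ℂ] HSpace δ)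
    (h10 : entry D (f 1) (f 0) =
      Complex.exp (((∑ j : Dishonest H, (x j : ℕ) : ℕ) * (Real.pi / 2) : ℝ) * Complex.I))
    (h01 : entry D (f 0) (f 1) =
      Complex.exp (-((∑ j : Dishonest H, (x j : ℕ) : ℕ) * (Real.pi / 2) : ℝ) * Complex.I)) :
    (inner ℂ (((1 / √2 : ℝ) : ℂ) • (ket (constLabel H f 0) + ket (constLabel H f 1)))
      (tensorOp PUnit (fun i : H => phaseFlip (angle v i (x i))) D (((1 / √2 : ℝ) : ℂ) •
        (ket (constLabel H f 0) + ket (constLabel H f 1))))).re =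
      Real.cos (Real.pi / 4 + weight x * (Real.pi / 2)) := by
  classical
  have hv : ∀ t : Fin 2, ∏ i : H, entry (phaseFlip.{u} (angle v i (x i))) ⟨t⟩ ⟨t⟩ = 0 := fun t =>
    Finset.prod_eq_zero (Finset.mem_univ v) (entry_phaseFlip_self _ _)
  rw [inner_ket_add_ket, ← sum_angle v x]
  simp only [entry_tensorOp, constLabel, hv, entry_phaseFlip_one_zero, entry_phaseFlip_zero_one,
    h10, h01, ← Complex.exp_sum, ← Complex.exp_add, if_true, zero_mul, zero_add, add_zero]
  rw [← Complex.cos_ofReal_re, Complex.cos]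
  congr 2
  rw [add_comm]
  simp only [← Finset.sum_mul, ← add_mul, Finset.sum_neg_distrib]
  push_cast
  congr 3
  ring

theorem svetlichny_equatorial
    (h10 : ∀ x : Dishonest H → Fin 2, entry (signedSum (fun a => ∑ j, (a j : ℕ)) (Q x)) (f 1) (f 0) =
      Complex.exp (((∑ j, (x j : ℕ) : ℕ) * (Real.pi / 2) : ℝ) * Complex.I))
    (h01 : ∀ x : Dishonest H → Fin 2, entry (signedSum (fun a => ∑ j, (a j : ℕ)) (Q x)) (f 0) (f 1) =
      Complex.exp (-((∑ j, (x j : ℕ) : ℕ) * (Real.pi / 2) : ℝ) * Complex.I)) (hN : 2 ≤ N) :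
    (equatorial v f Q hQ hQ1).svetlichny = 2 ^ (N - 1) * √2 := by
  have hc : ∀ x, (equatorial v f Q hQ hQ1).correlator x = svSign (weight x) * (√2 / 2) := by
    intro x
    rw [correlator_eq, ← cos_add_mul_pi_div_two,
      ← inner_tensorOp_phaseFlip v f x _ (h10 fun j => x j) (h01 fun j => x j)]
    rw [show (fun i : H => phaseFlip.{u} (angle v i (x i))) = _ from
      funext fun i => (signedSum_phaseFlip _).symm]
    rfl
  rw [svetlichny]
  have : ∀ x : Fin N → Fin 2, (-1 : ℝ) ^ (weight x * (weight x + 1) / 2) *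
      (equatorial v f Q hQ hQ1).correlator x = √2 / 2 := fun x => by
    rw [hc, ← mul_assoc]
    change svSign (weight x) * svSign (weight x) * _ = _
    rw [← sq, svSign_sq, one_mul]
  rw [Finset.sum_congr rfl fun x _ => this x]
  obtain ⟨n, rfl⟩ := Nat.exists_eq_add_of_le hN
  simp only [Finset.sum_const, Finset.card_univ, Fintype.card_pi, Fintype.card_fin,
    Finset.prod_const, nsmul_eq_mul]
  rw [show 2 + n - 1 = n + 1 by omega]
  push_cast
  ring

theorem exists_svetlichny_eq (hN : 2 ≤ N) (v : H) :
    ∃ S : Strategy.{u} H, S.svetlichny = 2 ^ (N - 1) * √2 := by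
  rcases isEmpty_or_nonempty (Dishonest H) with he | ⟨⟨c⟩⟩
  -- Without dishonest parties the group gets a one-dimensional system and `f` is constant.
  · refine ⟨equatorial v (δ := PUnit) (fun _ => PUnit.unit) (fun _ _ => 1)
      (fun _ _ => ContinuousLinearMap.isPositive_one) (fun _ => by simp),
      svetlichny_equatorial _ _ _ _ _ ?_ ?_ hN⟩ <;>
    · intro x
      simp [signedSum, entry_one]
  · have : Nonempty (Dishonest H) := ⟨c⟩
    set d : ℂ := ((Fintype.card (Dishonest H → Fin 2) : ℕ) : ℂ) with hd
    have hd0 : d ≠ 0 := by rw [hd]; exact_mod_cast Fintype.card_ne_zero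
    -- Even and odd output strings are equally many because the group is nonempty.
    have hz : ∑ a : Dishonest H → Fin 2, (-1 : ℂ) ^ (∑ j, (a j : ℕ)) = 0 := by
      have h := (Finset.prod_univ_sum (fun _ : Dishonest H => (Finset.univ : Finset (Fin 2)))
        fun _ t => (-1 : ℂ) ^ (t : ℕ)).symm
      rw [Fintype.piFinset_univ, Finset.prod_eq_zero (Finset.mem_univ c) (by simp)] at h
      simpa only [Finset.prod_pow_eq_pow_sum] using h
    set θ : (Dishonest H → Fin 2) → ℝ := fun x => (∑ j, (x j : ℕ) : ℕ) * (Real.pi / 2)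
    -- The group measures one qubit at the total angle of its inputs and outputs a uniformly random
    -- string of the resulting parity; `d` is the number of all strings.
    set Q : (Dishonest H → Fin 2) → (Dishonest H → Fin 2) →
        HSpace (ULift.{u} (Fin 2)) →L[ℂ] HSpace (ULift.{u} (Fin 2)) :=
      fun x a => d⁻¹ • (1 + (-1 : ℂ) ^ (∑ j, (a j : ℕ)) • phaseFlip (θ x)) with hQ
    have hQs : ∀ x, signedSum (fun a => ∑ j, (a j : ℕ)) (Q x) = phaseFlip (θ x) := by
      intro x
      have h1 : ∀ n : ℕ, (-1 : ℂ) ^ n • d⁻¹ • (1 + (-1 : ℂ) ^ n • phaseFlip.{u} (θ x)) =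
          (-1 : ℂ) ^ n • d⁻¹ • 1 + d⁻¹ • phaseFlip (θ x) := fun n => by
        rw [smul_add, smul_add, smul_comm _ d⁻¹ (_ • phaseFlip _), smul_smul ((-1) ^ n) ((-1) ^ n),
          ← mul_pow, neg_mul_neg, one_mul, one_pow, one_smul]
      simp only [signedSum, hQ, h1, Finset.sum_add_distrib, ← Finset.sum_smul, hz]
      rw [zero_smul, zero_add, Finset.sum_const, Finset.card_univ, ← Nat.cast_smul_eq_nsmul ℂ,
        smul_eq_mul, ← hd, mul_inv_cancel₀ hd0, one_smul]
    refine ⟨equatorial v (fun t => ⟨t⟩) Q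
      (fun x a => (isPositive_one_add_phaseFlip _ _).smul_of_nonneg ?_) (fun x => ?_),
      svetlichny_equatorial _ _ _ _ _ (fun x => ?_) (fun x => ?_) hN⟩
    · rw [hd, ← Complex.ofReal_natCast, ← Complex.ofReal_inv]
      exact_mod_cast inv_nonneg.2 (Nat.cast_nonneg _)
    · simp only [hQ, ← Finset.smul_sum, Finset.sum_add_distrib, ← Finset.sum_smul, hz]
      simp only [Finset.sum_const, Finset.card_univ, zero_smul, add_zero]
      rw [← Nat.cast_smul_eq_nsmul ℂ, smul_smul, ← hd, inv_mul_cancel₀ hd0, one_smul]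
    · rw [hQs, entry_phaseFlip_one_zero]
    · rw [hQs, entry_phaseFlip_zero_one]

end Strategy

end DishonestSelfTest

end

theorem theorem3 (N : ℕ) (hN : 2 ≤ N) (H : Finset (Fin N)) (verifier : Fin N)
    (h_verifier : verifier ∈ H) :
    IsGreatest (Set.range fun S : DishonestSelfTest.Strategy.{u} H => |S.svetlichny|)
      (2 ^ (N - 1) * √2) ∧
    ∀ S : DishonestSelfTest.Strategy.{u} H,
      |S.svetlichny| = 2 ^ (N - 1) * √2 → S.CertifiesGHZ := by
  have : Nontrivial (Fin N) := Fin.nontrivial_iff_two_le.2 hN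
  obtain ⟨b, hb⟩ := exists_ne verifier
  refine ⟨⟨?_, ?_⟩, fun S hS => ?_⟩
  · obtain ⟨S, hS⟩ := DishonestSelfTest.Strategy.exists_svetlichny_eq hN ⟨verifier, h_verifier⟩
    exact ⟨S, by simp only [hS]; exact abs_of_nonneg (by positivity)⟩
  · rintro _ ⟨S, rfl⟩
    -- The sign `σ = ±1` reduces the absolute value to two one-sided bounds.
    have h (σ : ℝ) (hσ : σ ^ 2 = 1) := S.svetlichny_le ⟨verifier, h_verifier⟩ hσ hb hN
    exact abs_le'.2 ⟨by simpa using h 1 (by norm_num), by simpa using h (-1) (by norm_num)⟩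
  · rcases abs_choice S.svetlichny with h | h
    · exact S.certifiesGHZ_of_max ⟨verifier, h_verifier⟩ (σ := 1) (by norm_num) hN (by linarith)
    · exact S.certifiesGHZ_of_max ⟨verifier, h_verifier⟩ (σ := -1) (by norm_num) hN (by linarith)
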